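/- Let $\Omega\subset\mathbb R^n$ be a bounded open set, let $\tau>0$, $k\in\mathbb R$, $\theta>1$, and let $\mu:[0,\infty)\to[0,\infty)$ be a locally absolutely continuous function with $\mu(0)>0$, $\tilde\mu:=\int_0^\infty\mu(s)\,ds<1$ and, for some $\alpha>0$, $\mu'(s)\le-\alpha\mu(s)$ for a.e. $s>0$. Consider the problem $$u_{tt}-\Delta u+\int_0^\infty\mu(s)\,\Delta u(x,t-s)\,ds+\theta|k|e^{\tau}u_t(x,t)+k\,u_t(x,t-\tau)=0\quad\text{in }\Omega\times(0,\infty),$$ with $u=0$ on $\partial\Omega\times(0,\infty)$ and with prescribed past $u=u_0$ for $t\le0$. Put $\eta^t(x,s)=u(x,t)-u(x,t-s)$. A solution is a function $u$ with values in $H^1_0(\Omega)$ such that $u\in C([0,\infty);H^1_0(\Omega))$ and $u_t\in C([0,\infty);L^2(\Omega))$, whose initial data satisfy $\eta^0\in L^2_\mu((0,\infty);H^1_0(\Omega))$ (the space of $L^2$ functions with respect to the measure $\mu(s)\,ds$) and $u_t|_{(-\tau,0)}\in L^2((-\tau,0);L^2(\Omega))$, and which satisfies, for all $w\in H^1_0(\Omega)$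 and $t\ge0$, $$\int_\Omega (u_t(t)-u_t(0))w\,dx+\int_0^t\Big[\int_\Omega\nabla u(r)\cdot\nabla w\,dx-\int_0^\infty\mu(s)\int_\Omega\nabla u(r-s)\cdot\nabla w\,dx\,ds+\theta|k|e^\tau\int_\Omega u_t(r)w\,dx+k\int_\Omega u_t(r-\tau)w\,dx\Big]dr=0.$$ (On $(-\tau,0)$ the symbol $u_t$ denotes the prescribed initial velocity history, which may be any element of $L^2((-\tau,0);L^2(\Omega))$; it need not be assumed to be the time derivative of $u_0$.) The solution is called strong if, moreover, $u\in C^1([0,\infty);H^1_0(\Omega))$, $u_t\in C^1([0,\infty);L^2(\Omega))$, $\eta^0(0)=0$ and $\partial_s\eta^0\in L^2_\mu((0,\infty);H^1_0(\Omega))$, and $u_t\in H^1((-\tau,0);L^2(\Omega))$ with value at $0$ equal to $u_t(0)$. Define the energy $$F(t)=\frac12\int_\Omega u_t^2(x,t)\,dx+\frac{1-\tilde\mu}2\int_\Omega|\nabla u(x,t)|^2dx+\frac12\int_0^\infty\!\!\int_\Omega\mu(s)|\nabla\eta^t(x,s)|^2dx\,ds+\frac{\theta|k|e^\tau}2\int_{t-\tau}^te^{-(t-s)}\int_\Omega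 u_t^2(x,s)\,dx\,ds .$$ Then for every solution $F$ is non-increasing on $[0,\infty)$, and for a.e. $t>0$ the function $F$ is differentiable at $t$, the function $s\mapsto\mu'(s)\int_\Omega|\nabla\eta^t(x,s)|^2dx$ is integrable on $(0,\infty)$, and $$F'(t)\le\frac12\int_0^\infty\!\!\int_\Omega\mu'(s)|\nabla\eta^t(x,s)|^2dx\,ds-\frac{|k|(\theta e^\tau-1)}2\int_\Omega u_t^2(x,t)\,dx-\frac{|k|(\theta-1)}2\int_\Omega u_t^2(x,t-\tau)\,dx-\frac{\theta|k|e^\tau}2\int_{t-\tau}^te^{-(t-s)}\int_\Omega u_t^2(x,s)\,dx\,ds .$$ If the solution is strong, all this holds at every $t\ge0$ (with the right derivative at $t=0$). -/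

import Mathlib

open MeasureTheory Set

noncomputable section

namespace ViscoelasticDelay

/-- Points of `ℝⁿ`. -/
abbrev Pt (n : ℕ) := EuclideanSpace ℝ (Fin n)

/-- The Hilbert space `L²(Ω)`. -/
abbrev L2 {n : ℕ} (Ω : Set (Pt n)) := Lp ℝ 2 (volume.restrict Ω)

/-- The Hilbert space `L²(Ω; ℝⁿ)` of square integrable vector fields. -/
abbrev L2Vec {n : ℕ} (Ω : Set (Pt n)) := Lp (Pt n) 2 (volume.restrict Ω)

/-- The pairs (class of `φ`, class of `∇φ`) for test functions `φ ∈ C_c^∞(Ω)`. -/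
def testPairs {n : ℕ} (Ω : Set (Pt n)) : Set (WithLp 2 (L2 Ω × L2Vec Ω)) :=
  {p | ∃ φ : Pt n → ℝ, ContDiff ℝ ((⊤ : ℕ∞) : WithTop ℕ∞) φ ∧ HasCompactSupport φ ∧
    tsupport φ ⊆ Ω ∧
    (p.fst =ᵐ[volume.restrict Ω] φ) ∧ (p.snd =ᵐ[volume.restrict Ω] gradient φ)}

/-- The Sobolev space `H¹₀(Ω)`: the closure of `C_c^∞(Ω)` in the `H¹` norm
`(‖w‖²_{L²} + ‖∇w‖²_{L²})^{1/2}`.  An element is stored as the pair `(w, ∇w)`.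
(`testPairs Ω` is itself a linear subspace, so that taking its span adds nothing.) -/
def H10 {n : ℕ} (Ω : Set (Pt n)) : Submodule ℝ (WithLp 2 (L2 Ω × L2Vec Ω)) :=
  (Submodule.span ℝ (testPairs Ω)).topologicalClosure

instance {n : ℕ} (Ω : Set (Pt n)) : CompleteSpace (H10 Ω) :=
  (Submodule.isClosed_topologicalClosure _).completeSpace_coe

/-- The inclusion `H¹₀(Ω) → L²(Ω)`. -/
def toL2 {n : ℕ} {Ω : Set (Pt n)} : H10 Ω →L[ℝ] L2 Ω :=
  (WithLp.fstL 2 ℝ (L2 Ω) (L2Vec Ω)).comp (H10 Ω).subtypeL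

/-- The weak gradient `∇ : H¹₀(Ω) → L²(Ω; ℝⁿ)`. -/
def grad {n : ℕ} {Ω : Set (Pt n)} : H10 Ω →L[ℝ] L2Vec Ω :=
  (WithLp.sndL 2 ℝ (L2 Ω) (L2Vec Ω)).comp (H10 Ω).subtypeL

/-- The standing assumptions on the memory kernel `μ : [0,∞) → [0,∞)` (values at negative
arguments are irrelevant). Local absolute continuity makes `μ'` exist almost everywhere. -/
structure IsMemoryKernel (μ : ℝ → ℝ) : Prop where
  nonneg : ∀ s, 0 ≤ s → 0 ≤ μ s
  locallyAC : ∀ T, 0 < T → AbsolutelyContinuousOnInterval μ 0 T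
  pos_zero : 0 < μ 0
  integrable : IntegrableOn μ (Ioi 0)
  integral_lt_one : ∫ s in Ioi 0, μ s < 1
  decay : ∃ α : ℝ, 0 < α ∧ ∀ᵐ s ∂(volume.restrict (Ioi (0 : ℝ))), deriv μ s ≤ -α * μ s

/-- The measure `μ(s) ds` on `(0,∞)`; thus `MemLp w 2 (memoryMeasure μ)` says that
`w ∈ L²_μ((0,∞); H¹₀(Ω))` when `w` has values in `H10 Ω`. -/
def memoryMeasure (μ : ℝ → ℝ) : Measure ℝ :=
  (volume.restrict (Ioi 0)).withDensity fun s => ENNReal.ofReal (μ s)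

/-- The relative history `η^t(s) = u(t) - u(t-s)`. -/
def eta {n : ℕ} {Ω : Set (Pt n)} (u : ℝ → H10 Ω) (t s : ℝ) : H10 Ω :=
  u t - u (t - s)

/-- `u` is a (weak, finite energy) solution, with velocity `v = u_t`, of

  `u_tt - Δu + ∫₀^∞ μ(s) Δu(t-s) ds + θ|k|e^τ u_t + k u_t(t-τ) = 0` in `Ω × (0,∞)`,
  `u = 0` on `∂Ω × (0,∞)`.

The restriction of `u` to `(-∞,0]` is the initial history, and the restriction of `v` to
`(-τ,0)` is the initial history of `u_t`. These initial data are arbitrary elements of the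
phase space `H¹₀(Ω) × L²(Ω) × L²_μ((0,∞); H¹₀(Ω)) × L²((-τ,0); L²(Ω))`; in particular the case
in which `v` is the time derivative of `u` on `(-τ,0)` as well is included. The boundary
condition is contained in `u(t) ∈ H¹₀(Ω)`; the equation is tested with the elements of `H¹₀(Ω)`
and integrated in time over `(0,t)`. -/
structure IsSolution {n : ℕ} (Ω : Set (Pt n)) (μ : ℝ → ℝ) (θ k τ : ℝ)
    (u : ℝ → H10 Ω) (v : ℝ → L2 Ω) : Prop where
  continuousOn_u : ContinuousOn u (Ici 0)
  continuousOn_v : ContinuousOn v (Ici 0)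
  hasDeriv_u : ∀ t, 0 ≤ t → HasDerivWithinAt (fun r => toL2 (u r)) (v t) (Ici 0) t
  history_u : MemLp (fun s => eta u 0 s) 2 (memoryMeasure μ)
  history_v : MemLp v 2 (volume.restrict (Ioo (-τ) 0))
  equation : ∀ w : H10 Ω, ∀ t, 0 ≤ t →
    inner ℝ (v t) (toL2 w) - inner ℝ (v 0) (toL2 w) +
      ∫ r in (0 : ℝ)..t,
        (inner ℝ (grad (u r)) (grad w)
          - (∫ s in Ioi 0, μ s * inner ℝ (grad (u (r - s))) (grad w))
          + θ * |k| * Real.exp τ * inner ℝ (v r) (toL2 w)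
          + k * inner ℝ (v (r - τ)) (toL2 w)) = 0

/-- The additional regularity of strong solutions (those starting in the domain of the
generator, i.e. `𝒰 = (u, u_t, η^t, z)`, `z(ρ,t) = u_t(t-τρ)`, is in
`C([0,∞); D(𝒜)) ∩ C¹([0,∞); ℋ)`): there are `p = u_t` with values in `H¹₀(Ω)` and
`a = u_tt` with values in `L²(Ω)` such that

* `u ∈ C¹([0,∞); H¹₀(Ω))` and `v ∈ C¹([0,∞); L²(Ω))`;
* `∂_s η⁰ = p(-·) ∈ L²_μ((0,∞); H¹₀(Ω))` and `η⁰(0) = 0` (what happens where `μ` vanishes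
  is irrelevant);
* `v ∈ H¹((-τ,0); L²(Ω))` with final value `v(0)`.

For a solution with these properties the equation itself gives, for every `t ≥ 0`, that
`Δ(u(t) - ∫₀^∞ μ(s) u(t-s) ds) ∈ L²(Ω)`. -/
def IsRegular {n : ℕ} {Ω : Set (Pt n)} (μ : ℝ → ℝ) (τ : ℝ)
    (u : ℝ → H10 Ω) (v : ℝ → L2 Ω) : Prop :=
  ∃ (p : ℝ → H10 Ω) (a : ℝ → L2 Ω),
    ContinuousOn p (Ici 0) ∧ (∀ t, 0 ≤ t → HasDerivWithinAt u (p t) (Ici 0) t) ∧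
    ContinuousOn a (Ici 0) ∧ (∀ t, 0 ≤ t → HasDerivWithinAt v (a t) (Ici 0) t) ∧
    MemLp (fun s => p (-s)) 2 (memoryMeasure μ) ∧
    (∀ s, 0 < s → 0 < μ s → u (-s) = u 0 - ∫ r in (0 : ℝ)..s, p (-r)) ∧
    MemLp a 2 (volume.restrict (Ioo (-τ) 0)) ∧
    (∀ t ∈ Icc (-τ) 0, v t = v 0 - ∫ r in t..(0 : ℝ), a r)

/-- The energy
`F(t) = ½∫u_t² + (1-μ̃)/2 ∫|∇u|² + ½∫₀^∞∫ μ(s)|∇η^t(s)|² + θ|k|e^τ/2 ∫_{t-τ}^t e^{-(t-s)}∫u_t²(s)`,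
where `μ̃ = ∫₀^∞ μ`. -/
def energy {n : ℕ} {Ω : Set (Pt n)} (μ : ℝ → ℝ) (θ k τ : ℝ)
    (u : ℝ → H10 Ω) (v : ℝ → L2 Ω) (t : ℝ) : ℝ :=
  1 / 2 * ‖v t‖ ^ 2
    + (1 - ∫ s in Ioi 0, μ s) / 2 * ‖grad (u t)‖ ^ 2
    + 1 / 2 * (∫ s in Ioi 0, μ s * ‖grad (eta u t s)‖ ^ 2)
    + θ * |k| * Real.exp τ / 2 * ∫ s in (t - τ)..t, Real.exp (-(t - s)) * ‖v s‖ ^ 2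

/-- The right-hand side of the estimate for `F'(t)`. -/
def dissipation {n : ℕ} {Ω : Set (Pt n)} (μ : ℝ → ℝ) (θ k τ : ℝ)
    (u : ℝ → H10 Ω) (v : ℝ → L2 Ω) (t : ℝ) : ℝ :=
  1 / 2 * (∫ s in Ioi 0, deriv μ s * ‖grad (eta u t s)‖ ^ 2)
    - |k| * (θ * Real.exp τ - 1) / 2 * ‖v t‖ ^ 2
    - |k| * (θ - 1) / 2 * ‖v (t - τ)‖ ^ 2
    - θ * |k| * Real.exp τ / 2 * ∫ s in (t - τ)..t, Real.exp (-(t - s)) * ‖v s‖ ^ 2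

end ViscoelasticDelay

end

/-!
The energy `F` satisfies the exact integrated balance `F(t) = F(0) + ∫₀ᵗ D(r) dr`
(`IsAbstractSolution.energy_eq`), where `D` (`energyRate`) is locally integrable and is bounded by
the claimed right-hand side through Young's inequality for the cross term `k ⟪u_t(t-τ), u_t(t)⟫`.
Since the right-hand side is nonpositive, `F` is non-increasing, and by Lebesgue's differentiation
theorem `F' = D` almost everywhere. For strong solutions `D` is continuous on `[0, ∞)`, so that
`F' = D` at every time.

The balance has three ingredients. Write `x = ∇u`, `γ(t) = ∫₀^∞ μ(s) x(t-s) ds` and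
`Q(t) = ∫₀^∞ μ(s) ‖x(t-s)‖² ds`, so that the elastic and memory energies together are
`½‖x‖² - ⟪γ, x⟫ + ½ Q`.

* Memory integrals `∫₀^∞ μ(s) X(t-s) ds` are absolutely continuous in `t` with derivative
  `μ(0) X(t) + ∫₀^∞ μ'(s) X(t-s) ds` (`HasHistory.memory_eq`), by Fubini's theorem and without any
  regularity of `X`. This applies to `γ` and to `Q`, and `½ Q' - ⟪γ', x⟫ = ½ ∫ μ'(s) ‖η^t(s)‖² ds`
  almost everywhere (`IsL2History.memory_balance`); Fubini's theorem also gives the integrability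
  of the last integrand for almost every `t`.
* The equation is a wave equation with a source in `L¹` in time and the absolutely continuous term
  `γ`. The energy identity for `½‖u_t‖² + ½‖x‖² - ⟪γ, x⟫` (`wave_energy_identity`) holds for weak
  solutions because Steklov averages in time solve the averaged equation, may be tested with their
  own time derivative, and converge.
* The delay term is `exp(-t)` times the integral of `exp(s) ‖u_t(s)‖²` over `(t-τ, t)`, and is
  differentiated by the product rule (`delay_energy_eq`).

For strong solutions, with `Y = ∂_t x`, integration by parts gives
`∫ μ'(s) ‖η^t(s)‖² ds = -2 ∫ μ(s) ⟪η^t(s), Y(t-s)⟫ ds` at every `t`; the right-hand side consists of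
memory integrals of `Y` and of `⟪x, Y⟫`, which are continuous in `t`
(`IsL2History.regular_dissipation`).
-/

noncomputable section

namespace ViscoelasticDelay

open Filter Topology

/-! ### Steklov averages in time -/

/-- The forward Steklov average `h⁻¹ ∫_t^{t+h} f`. -/
def steklov {E : Type*} [NormedAddCommGroup E] [NormedSpace ℝ E] (h : ℝ) (f : ℝ → E) (t : ℝ) : E :=
  h⁻¹ • ∫ r in t..(t + h), f r

section Steklov

variable {E : Type*} [NormedAddCommGroup E] [NormedSpace ℝ E]

theorem steklov_eq_primitive {f : ℝ → E} (hf : ∀ a b, IntervalIntegrable f volume a b) (h t : ℝ) :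
    steklov h f t = h⁻¹ • ((∫ r in (0 : ℝ)..(t + h), f r) - ∫ r in (0 : ℝ)..t, f r) := by
  rw [steklov, intervalIntegral.integral_interval_sub_left (hf _ _) (hf _ _)]

theorem continuous_steklov {f : ℝ → E} (hf : ∀ a b, IntervalIntegrable f volume a b) (h : ℝ) :
    Continuous (steklov h f) := by
  have hc := intervalIntegral.continuous_primitive hf 0
  have : steklov h f = fun t => h⁻¹ • ((∫ r in (0 : ℝ)..(t + h), f r) - ∫ r in (0 : ℝ)..t, f r) :=
    funext fun t => steklov_eq_primitive hf h t
  rw [this]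
  exact ((hc.comp (continuous_id.add continuous_const)).sub hc).const_smul _

theorem hasDerivAt_steklov [CompleteSpace E] {f : ℝ → E} (hf : Continuous f) (h t : ℝ) :
    HasDerivAt (steklov h f) (h⁻¹ • (f (t + h) - f t)) t := by
  have hi : ∀ a b, IntervalIntegrable f volume a b := fun a b => hf.intervalIntegrable a b
  have : steklov h f = fun t => h⁻¹ • ((∫ r in (0 : ℝ)..(t + h), f r) - ∫ r in (0 : ℝ)..t, f r) :=
    funext fun t => steklov_eq_primitive hi h t
  rw [this]
  have hd : ∀ x, HasDerivAt (fun t => ∫ r in (0 : ℝ)..t, f r) (f x) x := fun x =>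
    hf.integral_hasStrictDerivAt 0 x |>.hasDerivAt
  exact (((hd (t + h)).comp_add_const t h).sub (hd t)).const_smul _

theorem tendsto_steklov [CompleteSpace E] {f : ℝ → E} (hf : Continuous f) (t : ℝ) :
    Tendsto (fun h => steklov h f t) (𝓝[>] 0) (𝓝 (f t)) := by
  have hd : HasDerivAt (fun t => ∫ r in (0 : ℝ)..t, f r) (f t) t :=
    hf.integral_hasStrictDerivAt 0 t |>.hasDerivAt
  refine hd.tendsto_slope_zero_right.congr fun h => ?_
  rw [steklov_eq_primitive fun a b => hf.intervalIntegrable a b]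

theorem steklov_sub {f g : ℝ → E} (hf : ∀ a b, IntervalIntegrable f volume a b)
    (hg : ∀ a b, IntervalIntegrable g volume a b) (h t : ℝ) :
    steklov h (fun r => f r - g r) t = steklov h f t - steklov h g t := by
  simp only [steklov]
  rw [intervalIntegral.integral_sub (hf _ _) (hg _ _), smul_sub]

theorem norm_steklov_le {f : ℝ → E} {h t C : ℝ} (hh : 0 < h)
    (hC : ∀ r ∈ Icc t (t + h), ‖f r‖ ≤ C) : ‖steklov h f t‖ ≤ C := by
  rw [steklov, norm_smul, norm_inv, Real.norm_of_nonneg hh.le, inv_mul_le_iff₀ hh, mul_comm]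
  have := intervalIntegral.norm_integral_le_of_norm_le_const (f := f) (a := t) (b := t + h) (C := C)
    fun r hr => hC r (by
      rw [uIoc_of_le (by linarith)] at hr
      exact Ioc_subset_Icc_self hr)
  simpa [abs_of_pos hh] using this

theorem norm_steklov_sub_le [CompleteSpace E] {f : ℝ → E} (hf : Continuous f) {h t C : ℝ}
    (hh : 0 < h) (hC : ∀ r ∈ Icc t (t + h), ‖f r - f t‖ ≤ C) : ‖steklov h f t - f t‖ ≤ C := by
  have hcst : steklov h (fun _ => f t) t = f t := by
    simp [steklov, smul_smul, inv_mul_cancel₀ hh.ne']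
  have := norm_steklov_le hh hC
  rwa [steklov_sub (fun a b => hf.intervalIntegrable a b) (fun a b => by simp), hcst] at this

/-- Steklov averaging does not increase the `L¹` norm. With `M` the primitive of `‖f‖`, the bound
is `∫₀^T (M(r+h) - M(r)) dr = ∫_T^{T+h} M - ∫₀^h M ≤ h M(T+h)`. -/
theorem integral_norm_steklov_le {f : ℝ → E} (hf : Integrable f) {h T : ℝ} (hh : 0 < h)
    (hT : 0 ≤ T) : ∫ r in (0 : ℝ)..T, ‖steklov h f r‖ ≤ ∫ r, ‖f r‖ := by
  have hi : ∀ a b, IntervalIntegrable f volume a b := fun a b => hf.intervalIntegrable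
  have hin : ∀ a b, IntervalIntegrable (fun r => ‖f r‖) volume a b :=
    fun a b => hf.norm.intervalIntegrable
  set M : ℝ → ℝ := fun t => ∫ r in (0 : ℝ)..t, ‖f r‖ with hM
  have hMc : Continuous M := intervalIntegral.continuous_primitive hin 0
  have hMi : ∀ a b, IntervalIntegrable M volume a b := fun a b => hMc.intervalIntegrable a b
  have hM0 : ∀ t, 0 ≤ t → 0 ≤ M t := fun t ht =>
    intervalIntegral.integral_nonneg ht fun _ _ => norm_nonneg _
  have hMle : ∀ t, 0 ≤ t → M t ≤ ∫ r, ‖f r‖ := fun t ht => by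
    rw [hM]; simp only
    rw [intervalIntegral.integral_of_le ht]
    exact setIntegral_le_integral hf.norm (Eventually.of_forall fun _ => norm_nonneg _)
  have h1 : ∀ r, ‖steklov h f r‖ ≤ h⁻¹ * (M (r + h) - M r) := fun r => by
    rw [steklov, norm_smul, norm_inv, Real.norm_of_nonneg hh.le]
    refine mul_le_mul_of_nonneg_left ?_ (inv_nonneg.2 hh.le)
    rw [hM]; simp only
    rw [intervalIntegral.integral_interval_sub_left (hin _ _) (hin _ _)]
    exact intervalIntegral.norm_integral_le_integral_norm (by linarith)
  have hMh : Continuous fun r => M (r + h) := hMc.comp (continuous_id.add continuous_const)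
  calc ∫ r in (0 : ℝ)..T, ‖steklov h f r‖
      ≤ ∫ r in (0 : ℝ)..T, h⁻¹ * (M (r + h) - M r) :=
        intervalIntegral.integral_mono_on hT ((continuous_steklov hi h).norm.intervalIntegrable _ _)
          ((continuous_const.mul (hMh.sub hMc)).intervalIntegrable _ _) fun r _ => h1 r
    _ = h⁻¹ * ((∫ r in T..(T + h), M r) - ∫ r in (0 : ℝ)..h, M r) := by
        rw [intervalIntegral.integral_const_mul,
          intervalIntegral.integral_sub (hMh.intervalIntegrable _ _) (hMi _ _),
          intervalIntegral.integral_comp_add_right, zero_add]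
        have e1 := intervalIntegral.integral_add_adjacent_intervals (hMi 0 h) (hMi h (T + h))
        have e2 := intervalIntegral.integral_add_adjacent_intervals (hMi 0 T) (hMi T (T + h))
        congr 1
        linarith
    _ ≤ h⁻¹ * (h * ∫ r, ‖f r‖) := by
        refine mul_le_mul_of_nonneg_left ?_ (inv_nonneg.2 hh.le)
        have e1 : 0 ≤ ∫ r in (0 : ℝ)..h, M r :=
          intervalIntegral.integral_nonneg hh.le fun r hr => hM0 r hr.1
        have e2 : ∫ r in T..(T + h), M r ≤ ∫ _ in T..(T + h), ∫ r, ‖f r‖ :=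
          intervalIntegral.integral_mono_on (by linarith) (hMi _ _) (by simp)
            fun r hr => hMle r (hT.trans hr.1)
        rw [intervalIntegral.integral_const, smul_eq_mul] at e2
        have : T + h - T = h := by ring
        rw [this] at e2
        linarith
    _ = ∫ r, ‖f r‖ := by rw [← mul_assoc, inv_mul_cancel₀ hh.ne', one_mul]

/-- `L¹` convergence of Steklov averages: approximate by a continuous function of compact support
and use the contraction property `integral_norm_steklov_le`. -/
theorem tendsto_integral_norm_steklov_sub [CompleteSpace E] {f : ℝ → E} (hf : Integrable f) {T : ℝ}
    (hT : 0 ≤ T) :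
    Tendsto (fun h => ∫ r in (0 : ℝ)..T, ‖steklov h f r - f r‖) (𝓝[>] 0) (𝓝 0) := by
  have hi : ∀ a b, IntervalIntegrable f volume a b := fun a b => hf.intervalIntegrable
  refine Metric.tendsto_nhds.2 fun ε hε => ?_
  set δ : ℝ := ε / (2 * (2 + T)) with hδ
  have hδ0 : 0 < δ := by positivity
  obtain ⟨φ, hφs, hφ, hφc, hφi⟩ := hf.exists_hasCompactSupport_integral_sub_le hδ0
  have huc : UniformContinuous φ := hφs.uniformContinuous_of_continuous hφc
  obtain ⟨η, hη, hηφ⟩ := Metric.uniformContinuous_iff.1 huc δ hδ0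
  filter_upwards [Ioo_mem_nhdsGT hη] with h hh
  have hφ' : ∀ a b, IntervalIntegrable φ volume a b := fun a b => hφc.intervalIntegrable a b
  have hd : Integrable (fun r => f r - φ r) := hf.sub hφi
  have hdi : ∀ a b, IntervalIntegrable (fun r => f r - φ r) volume a b :=
    fun a b => hd.intervalIntegrable
  have hA : IntervalIntegrable (fun r => ‖steklov h (fun r => f r - φ r) r‖) volume 0 T :=
    (continuous_steklov hdi h).norm.intervalIntegrable _ _
  have hB : IntervalIntegrable (fun r => ‖f r - φ r‖) volume 0 T := (hdi 0 T).norm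
  have hle : ∫ r in (0 : ℝ)..T, ‖steklov h f r - f r‖ ≤
      ∫ r in (0 : ℝ)..T, (‖steklov h (fun r => f r - φ r) r‖ + δ + ‖f r - φ r‖) := by
    refine intervalIntegral.integral_mono_on hT
      (((continuous_steklov hi h).intervalIntegrable _ _).sub (hi _ _)).norm
      ((hA.add (by simp)).add hB) fun r _ => ?_
    have h1 : ‖steklov h φ r - φ r‖ ≤ δ := norm_steklov_sub_le hφc hh.1 fun x hx => by
      have := hηφ (a := x) (b := r) (by
        rw [Real.dist_eq, abs_of_nonneg (by linarith [hx.1])]; linarith [hx.2, hh.2])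
      rw [dist_eq_norm] at this
      exact this.le
    have h2 : steklov h f r - f r = steklov h (fun r => f r - φ r) r + (steklov h φ r - φ r)
        - (f r - φ r) := by
      rw [steklov_sub hi hφ']; abel
    rw [h2]
    exact (norm_sub_le _ _).trans (by gcongr; exact (norm_add_le _ _).trans (by gcongr))
  rw [intervalIntegral.integral_add (hA.add (by simp)) hB,
    intervalIntegral.integral_add hA (by simp), intervalIntegral.integral_const] at hle
  have e1 := (integral_norm_steklov_le hd hh.1 hT).trans hφ
  have e2 : ∫ r in (0 : ℝ)..T, ‖f r - φ r‖ ≤ δ := by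
    rw [intervalIntegral.integral_of_le hT]
    exact (setIntegral_le_integral hd.norm (Eventually.of_forall fun _ => norm_nonneg _)).trans hφ
  have e3 : 0 ≤ ∫ r in (0 : ℝ)..T, ‖steklov h f r - f r‖ :=
    intervalIntegral.integral_nonneg hT fun _ _ => norm_nonneg _
  rw [Real.dist_eq, sub_zero, abs_of_nonneg e3]
  have e4 : δ * (2 + T) = ε / 2 := by rw [hδ]; field_simp
  simp only [sub_zero, smul_eq_mul] at hle
  nlinarith

end Steklov

section SteklovInner

variable {H : Type*} [NormedAddCommGroup H] [InnerProductSpace ℝ H]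

theorem intervalIntegrable_inner {f b : ℝ → H} {s t : ℝ} (hf : IntervalIntegrable f volume s t)
    (hb : ContinuousOn b (uIcc s t)) :
    IntervalIntegrable (fun r => inner ℝ (f r) (b r)) volume s t := by
  obtain ⟨C, hC⟩ := (isCompact_uIcc.image_of_continuousOn hb).isBounded.exists_norm_le
  have hbm : AEStronglyMeasurable b (volume.restrict (uIoc s t)) :=
    (hb.aestronglyMeasurable measurableSet_uIcc).mono_measure
      (Measure.restrict_mono uIoc_subset_uIcc le_rfl)
  rw [intervalIntegrable_iff] at hf ⊢
  refine (hf.norm.mul_const C).mono' (hf.aestronglyMeasurable.inner hbm) ?_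
  filter_upwards [ae_restrict_mem measurableSet_uIoc] with r hr
  exact (norm_inner_le_norm _ _).trans
    (mul_le_mul_of_nonneg_left (hC _ (mem_image_of_mem _ (uIoc_subset_uIcc hr))) (norm_nonneg _))

/-- Pairings of Steklov averages converge: one factor converges in `L¹`, the other locally
uniformly. -/
theorem tendsto_integral_inner_steklov [CompleteSpace H] {f b : ℝ → H} (hf : Integrable f)
    (hb : Continuous b) {T : ℝ} (hT : 0 ≤ T) :
    Tendsto (fun h => ∫ r in (0 : ℝ)..T, inner ℝ (steklov h f r) (steklov h b r)) (𝓝[>] 0)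
      (𝓝 (∫ r in (0 : ℝ)..T, inner ℝ (f r) (b r))) := by
  have hi : ∀ a b, IntervalIntegrable f volume a b := fun a b => hf.intervalIntegrable
  have hbi : ∀ s t, IntervalIntegrable b volume s t := fun s t => hb.intervalIntegrable s t
  obtain ⟨C, hC⟩ := ((isCompact_Icc (a := (0 : ℝ)) (b := T + 1)).image hb).isBounded.exists_norm_le
  have hC' : ∀ r ∈ Icc (0 : ℝ) (T + 1), ‖b r‖ ≤ C := fun r hr => hC _ (mem_image_of_mem _ hr)
  have hS : ∀ h ∈ Ioo (0 : ℝ) 1, ∀ r ∈ Icc (0 : ℝ) T, ‖steklov h b r‖ ≤ C := fun h hh r hr =>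
    norm_steklov_le hh.1 fun x hx => hC' x ⟨hr.1.trans hx.1, by linarith [hx.2, hr.2, hh.2]⟩
  have t1 : Tendsto (fun h => ∫ r in (0 : ℝ)..T, inner ℝ (steklov h f r - f r) (steklov h b r))
      (𝓝[>] 0) (𝓝 0) := by
    have t0 := (tendsto_integral_norm_steklov_sub hf hT).mul_const C
    rw [zero_mul] at t0
    refine squeeze_zero_norm' ?_ t0
    filter_upwards [Ioo_mem_nhdsGT (zero_lt_one' ℝ)] with h hh
    rw [← intervalIntegral.integral_mul_const]
    refine intervalIntegral.norm_integral_le_of_norm_le hT ?_ ?_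
    · filter_upwards with r hr
      exact (norm_inner_le_norm _ _).trans
        (mul_le_mul_of_nonneg_left (hS h hh r (Ioc_subset_Icc_self hr)) (norm_nonneg _))
    · exact (((continuous_steklov hi h).intervalIntegrable _ _).sub (hi _ _)).norm.mul_const _
  have t2 : Tendsto (fun h => ∫ r in (0 : ℝ)..T, inner ℝ (f r) (steklov h b r))
      (𝓝[>] 0) (𝓝 (∫ r in (0 : ℝ)..T, inner ℝ (f r) (b r))) := by
    refine intervalIntegral.tendsto_integral_filter_of_dominated_convergence
      (fun r => ‖f r‖ * C) ?_ ?_ ((hi _ _).norm.mul_const _) ?_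
    · filter_upwards with h
      exact hf.aestronglyMeasurable.restrict.inner
        (continuous_steklov hbi h).aestronglyMeasurable
    · filter_upwards [Ioo_mem_nhdsGT (zero_lt_one' ℝ)] with h hh
      filter_upwards with r hr
      rw [uIoc_of_le hT] at hr
      exact (norm_inner_le_norm _ _).trans
        (mul_le_mul_of_nonneg_left (hS h hh r (Ioc_subset_Icc_self hr)) (norm_nonneg _))
    · filter_upwards with r _
      exact (tendsto_const_nhds).inner (tendsto_steklov hb r)
  have t3 := t1.add t2
  rw [zero_add] at t3
  refine t3.congr fun h => ?_
  rw [← intervalIntegral.integral_add]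
  · refine intervalIntegral.integral_congr fun r _ => ?_
    simp only [inner_sub_left]
    ring
  · exact intervalIntegrable_inner (((continuous_steklov hi h).intervalIntegrable _ _).sub (hi _ _))
      (continuous_steklov hbi h).continuousOn
  · exact intervalIntegrable_inner (hi _ _) (continuous_steklov hbi h).continuousOn

end SteklovInner

/-! ### The product rule and the energy identity for the abstract wave equation -/

section Identities

variable {E : Type*} [NormedAddCommGroup E] [NormedSpace ℝ E]
  {H : Type*} [NormedAddCommGroup H] [InnerProductSpace ℝ H] [CompleteSpace H]
  {W : Type*} [NormedAddCommGroup W] [InnerProductSpace ℝ W] [CompleteSpace W]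

theorem intervalIntegral_inner_const {f : ℝ → H} {s t : ℝ} (hf : IntervalIntegrable f volume s t)
    (c : H) : ∫ r in s..t, inner ℝ (f r) c = inner ℝ (∫ r in s..t, f r) c := by
  have := (innerSL ℝ c).intervalIntegral_comp_comm hf
  simp only [innerSL_apply_apply] at this
  simp only [real_inner_comm c]
  exact this

/-- The Steklov average of a derivative is the difference quotient of the primitive. -/
theorem steklov_deriv {a a' : ℝ → E} (ha' : Integrable a')
    (ha : ∀ t, a t = a 0 + ∫ r in (0 : ℝ)..t, a' r) (h t : ℝ) :
    steklov h a' t = h⁻¹ • (a (t + h) - a t) := by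
  rw [steklov_eq_primitive fun _ _ => ha'.intervalIntegrable, ha (t + h), ha t,
    add_sub_add_left_eq_sub]

theorem continuous_of_primitive {a a' : ℝ → E} (ha' : Integrable a')
    (ha : ∀ t, a t = a 0 + ∫ r in (0 : ℝ)..t, a' r) : Continuous a := by
  rw [funext ha]
  exact continuous_const.add
    (intervalIntegral.continuous_primitive (fun _ _ => ha'.intervalIntegrable) 0)

theorem exists_integrable_extension {a' : ℝ → E}
    {T : ℝ} (hT : 0 ≤ T) (ha' : IntervalIntegrable a' volume 0 T) :
    ∃ b' : ℝ → E, Integrable b' ∧ (∀ r ∈ Ioc 0 T, b' r = a' r) ∧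
      ∀ t ∈ Icc 0 T, ∫ r in (0 : ℝ)..t, b' r = ∫ r in (0 : ℝ)..t, a' r := by
  have hb : ∀ r ∈ Ioc 0 T, (Ioc 0 T).indicator a' r = a' r := fun r hr => indicator_of_mem hr a'
  refine ⟨(Ioc 0 T).indicator a', ?_, hb, fun t ht => ?_⟩
  · rw [integrable_indicator_iff measurableSet_Ioc]
    exact (intervalIntegrable_iff_integrableOn_Ioc_of_le hT).1 ha'
  · refine intervalIntegral.integral_congr_ae (Eventually.of_forall fun r hr => hb r ?_)
    rw [uIoc_of_le ht.1] at hr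
    exact ⟨hr.1, hr.2.trans ht.2⟩

/-- Product rule for primitives with values in a Hilbert space. -/
theorem inner_primitive {a a' b b' : ℝ → H} {T : ℝ} (hT : 0 ≤ T)
    (ha' : IntervalIntegrable a' volume 0 T) (hb' : IntervalIntegrable b' volume 0 T)
    (ha : ∀ t ∈ Icc 0 T, a t = a 0 + ∫ r in (0 : ℝ)..t, a' r)
    (hb : ∀ t ∈ Icc 0 T, b t = b 0 + ∫ r in (0 : ℝ)..t, b' r) :
    inner ℝ (a T) (b T) = inner ℝ (a 0) (b 0) +
      ∫ r in (0 : ℝ)..T, (inner ℝ (a' r) (b r) + inner ℝ (a r) (b' r)) := by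
  obtain ⟨A', hA'i, hA', hA'p⟩ := exists_integrable_extension hT ha'
  obtain ⟨B', hB'i, hB', hB'p⟩ := exists_integrable_extension hT hb'
  set A : ℝ → H := fun t => a 0 + ∫ r in (0 : ℝ)..t, A' r with hAdef
  set B : ℝ → H := fun t => b 0 + ∫ r in (0 : ℝ)..t, B' r with hBdef
  have hA0 : A 0 = a 0 := by simp [hAdef]
  have hB0 : B 0 = b 0 := by simp [hBdef]
  have hAp : ∀ t, A t = A 0 + ∫ r in (0 : ℝ)..t, A' r := fun t => by rw [hA0]
  have hBp : ∀ t, B t = B 0 + ∫ r in (0 : ℝ)..t, B' r := fun t => by rw [hB0]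
  have hAa : ∀ t ∈ Icc 0 T, A t = a t := fun t ht => by rw [ha t ht, hAp, hA0, hA'p t ht]
  have hBb : ∀ t ∈ Icc 0 T, B t = b t := fun t ht => by rw [hb t ht, hBp, hB0, hB'p t ht]
  have hAc := continuous_of_primitive hA'i hAp
  have hBc := continuous_of_primitive hB'i hBp
  have hA'c : ∀ h, Continuous (steklov h A') :=
    continuous_steklov fun _ _ => hA'i.intervalIntegrable
  have hB'c : ∀ h, Continuous (steklov h B') :=
    continuous_steklov fun _ _ => hB'i.intervalIntegrable
  have hSA : ∀ h, Continuous (steklov h A) :=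
    continuous_steklov fun _ _ => hAc.intervalIntegrable _ _
  have hSB : ∀ h, Continuous (steklov h B) :=
    continuous_steklov fun _ _ => hBc.intervalIntegrable _ _
  have key : ∀ h, (∫ r in (0 : ℝ)..T, inner ℝ (steklov h A' r) (steklov h B r)) +
      (∫ r in (0 : ℝ)..T, inner ℝ (steklov h B' r) (steklov h A r)) =
      inner ℝ (steklov h A T) (steklov h B T) - inner ℝ (steklov h A 0) (steklov h B 0) := by
    intro h
    rw [← intervalIntegral.integral_add (((hA'c h).inner (hSB h)).intervalIntegrable _ _)
      (((hB'c h).inner (hSA h)).intervalIntegrable _ _)]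
    refine intervalIntegral.integral_eq_sub_of_hasDerivAt
      (f := fun r => inner ℝ (steklov h A r) (steklov h B r)) (fun r _ => ?_)
      ((((hA'c h).inner (hSB h)).add ((hB'c h).inner (hSA h))).intervalIntegrable _ _)
    have h1 := (hasDerivAt_steklov hAc h r).inner ℝ (hasDerivAt_steklov hBc h r)
    rw [← steklov_deriv hA'i hAp, ← steklov_deriv hB'i hBp] at h1
    refine h1.congr_deriv ?_
    rw [real_inner_comm (steklov h B' r)]
    ring
  have l1 := (tendsto_integral_inner_steklov hA'i hBc hT).add
    (tendsto_integral_inner_steklov hB'i hAc hT)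
  have l2 := ((tendsto_steklov hAc T).inner (𝕜 := ℝ) (tendsto_steklov hBc T)).sub
    ((tendsto_steklov hAc 0).inner (𝕜 := ℝ) (tendsto_steklov hBc 0))
  have l3 := tendsto_nhds_unique (l1.congr key) l2
  rw [hAa T ⟨hT, le_rfl⟩, hBb T ⟨hT, le_rfl⟩, hA0, hB0] at l3
  have l4 : ∫ r in (0 : ℝ)..T, (inner ℝ (a' r) (b r) + inner ℝ (a r) (b' r)) =
      ∫ r in (0 : ℝ)..T, (inner ℝ (A' r) (B r) + inner ℝ (B' r) (A r)) := by
    refine intervalIntegral.integral_congr_ae (Eventually.of_forall fun r hr => ?_)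
    rw [uIoc_of_le hT] at hr
    rw [hA' r hr, hB' r hr, hAa r (Ioc_subset_Icc_self hr), hBb r (Ioc_subset_Icc_self hr),
      real_inner_comm (a r)]
  rw [l4, intervalIntegral.integral_add]
  · linarith
  · exact intervalIntegrable_inner hA'i.intervalIntegrable hBc.continuousOn
  · exact intervalIntegrable_inner hB'i.intervalIntegrable hAc.continuousOn

variable {V : Type*} [NormedAddCommGroup V] [NormedSpace ℝ V]

/-- Energy identity for the abstract wave equation `v' + G*(Gu - γ) + f = 0`, `(Tu)' = v`, where
`u` is only continuous with values in `V`, so that `v` is not an admissible test function. The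
Steklov averages in time satisfy the same equation and have `(S_h u)'` with values in `V`; the
identity for them passes to the limit because only `f` and `γ'`, which lie in `L¹` in time, and
continuous functions occur in it. -/
theorem wave_energy_identity (T : V →L[ℝ] H) (G : V →L[ℝ] W) {u : ℝ → V} {v f : ℝ → H}
    {γ γ' : ℝ → W} (hu : Continuous u) (hv : Continuous v)
    (hf : ∀ t, 0 ≤ t → IntervalIntegrable f volume 0 t)
    (hγ' : ∀ t, 0 ≤ t → IntervalIntegrable γ' volume 0 t)
    (hγ : ∀ t, 0 ≤ t → γ t = γ 0 + ∫ r in (0 : ℝ)..t, γ' r)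
    (hTu : ∀ t, 0 ≤ t → T (u t) = T (u 0) + ∫ r in (0 : ℝ)..t, v r)
    (heq : ∀ w, ∀ t, 0 ≤ t → inner ℝ (v t) (T w) - inner ℝ (v 0) (T w) +
      ∫ r in (0 : ℝ)..t, (inner ℝ (G (u r)) (G w) - inner ℝ (γ r) (G w) + inner ℝ (f r) (T w)) = 0)
    {t : ℝ} (ht : 0 ≤ t) :
    1 / 2 * ‖v t‖ ^ 2 + 1 / 2 * ‖G (u t)‖ ^ 2 - inner ℝ (γ t) (G (u t)) =
      1 / 2 * ‖v 0‖ ^ 2 + 1 / 2 * ‖G (u 0)‖ ^ 2 - inner ℝ (γ 0) (G (u 0)) -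
        ∫ r in (0 : ℝ)..t, (inner ℝ (f r) (v r) + inner ℝ (γ' r) (G (u r))) := by
  have ht1 : 0 ≤ t + 1 := by linarith
  obtain ⟨F, hFi, hFf, hFp⟩ := exists_integrable_extension ht1 (hf _ ht1)
  obtain ⟨Γ', hΓ'i, hΓ', hΓ'p⟩ := exists_integrable_extension ht1 (hγ' _ ht1)
  set Γ : ℝ → W := fun t => γ 0 + ∫ r in (0 : ℝ)..t, Γ' r with hΓdef
  have hΓ0 : Γ 0 = γ 0 := by simp [hΓdef]
  have hΓp : ∀ t, Γ t = Γ 0 + ∫ r in (0 : ℝ)..t, Γ' r := fun t => by rw [hΓ0]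
  have hΓγ : ∀ s ∈ Icc 0 (t + 1), Γ s = γ s := fun s hs => by
    rw [hγ s hs.1, hΓp, hΓ0, hΓ'p s hs]
  have hΓc := continuous_of_primitive hΓ'i hΓp
  have hGu : Continuous fun r => G (u r) := G.continuous.comp hu
  have hFii : ∀ a b, IntervalIntegrable F volume a b := fun _ _ => hFi.intervalIntegrable
  have hvi : ∀ a b, IntervalIntegrable v volume a b := fun _ _ => hv.intervalIntegrable _ _
  have hGui : ∀ a b, IntervalIntegrable (fun r => G (u r)) volume a b :=
    fun _ _ => hGu.intervalIntegrable _ _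
  have hΓii : ∀ a b, IntervalIntegrable Γ volume a b := fun _ _ => hΓc.intervalIntegrable _ _
  have hSF : ∀ h, Continuous (steklov h F) := continuous_steklov hFii
  have hSΓ' : ∀ h, Continuous (steklov h Γ') :=
    continuous_steklov fun _ _ => hΓ'i.intervalIntegrable
  have hSv : ∀ h, Continuous (steklov h v) := continuous_steklov hvi
  have hSu : ∀ h, Continuous (steklov h fun r => G (u r)) := continuous_steklov hGui
  -- the equation integrated over `(r, r + h)`, tested with `h⁻¹ (u (r + h) - u r)`
  have hstep : ∀ h ∈ Ioo (0 : ℝ) 1, ∀ r ∈ Icc 0 t,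
      inner ℝ (h⁻¹ • (v (r + h) - v r)) (steklov h v r) +
        inner ℝ (steklov h (fun r => G (u r)) r - steklov h Γ r) (h⁻¹ • (G (u (r + h)) - G (u r)))
        + inner ℝ (steklov h F r) (steklov h v r) = 0 := by
    intro h hh r hr
    set w : V := h⁻¹ • (u (r + h) - u r) with hw
    have hr' : 0 ≤ r + h := by linarith [hr.1, hh.1]
    have hTw : T w = steklov h v r := by
      rw [steklov_eq_primitive hvi, hw, map_smul, map_sub, hTu _ hr', hTu _ hr.1,
        add_sub_add_left_eq_sub]
    have hGw : G w = h⁻¹ • (G (u (r + h)) - G (u r)) := by rw [hw, map_smul, map_sub]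
    rw [← hTw, ← hGw]
    have hint : ∀ s ∈ Icc 0 (t + 1), ∫ x in (0 : ℝ)..s,
        (inner ℝ (G (u x)) (G w) - inner ℝ (γ x) (G w) + inner ℝ (f x) (T w)) =
        inner ℝ (∫ x in (0 : ℝ)..s, G (u x)) (G w) - inner ℝ (∫ x in (0 : ℝ)..s, Γ x) (G w)
          + inner ℝ (∫ x in (0 : ℝ)..s, F x) (T w) := by
      intro s hs
      rw [← intervalIntegral_inner_const (hGui _ _), ← intervalIntegral_inner_const (hΓii _ _),
        ← intervalIntegral_inner_const (hFii _ _), ← intervalIntegral.integral_sub,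
        ← intervalIntegral.integral_add]
      · refine intervalIntegral.integral_congr_ae (Eventually.of_forall fun x hx => ?_)
        rw [uIoc_of_le hs.1] at hx
        rw [hFf x ⟨hx.1, hx.2.trans hs.2⟩, hΓγ x ⟨hx.1.le, hx.2.trans hs.2⟩]
      · exact (intervalIntegrable_inner (hGui _ _) continuousOn_const).sub
          (intervalIntegrable_inner (hΓii _ _) continuousOn_const)
      · exact intervalIntegrable_inner (hFii _ _) continuousOn_const
      · exact intervalIntegrable_inner (hGui _ _) continuousOn_const
      · exact intervalIntegrable_inner (hΓii _ _) continuousOn_const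
    have e1 := heq w _ hr'
    have e2 := heq w _ hr.1
    rw [hint _ ⟨hr', by linarith [hr.2, hh.2]⟩] at e1
    rw [hint _ ⟨hr.1, by linarith [hr.2]⟩] at e2
    rw [steklov_eq_primitive hGui, steklov_eq_primitive hΓii, steklov_eq_primitive hFii]
    simp only [inner_sub_left, real_inner_smul_left]
    linear_combination h⁻¹ * (e1 - e2)
  have key : ∀ h ∈ Ioo (0 : ℝ) 1,
      -((∫ r in (0 : ℝ)..t, inner ℝ (steklov h F r) (steklov h v r)) +
        ∫ r in (0 : ℝ)..t, inner ℝ (steklov h Γ' r) (steklov h (fun r => G (u r)) r)) =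
      (1 / 2 * ‖steklov h v t‖ ^ 2 + 1 / 2 * ‖steklov h (fun r => G (u r)) t‖ ^ 2
        - inner ℝ (steklov h Γ t) (steklov h (fun r => G (u r)) t)) -
      (1 / 2 * ‖steklov h v 0‖ ^ 2 + 1 / 2 * ‖steklov h (fun r => G (u r)) 0‖ ^ 2
        - inner ℝ (steklov h Γ 0) (steklov h (fun r => G (u r)) 0)) := by
    intro h hh
    have i1 : Continuous fun r => inner ℝ (steklov h F r) (steklov h v r) := (hSF h).inner (hSv h)
    have i2 : Continuous fun r => inner ℝ (steklov h Γ' r) (steklov h (fun r => G (u r)) r) :=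
      (hSΓ' h).inner (hSu h)
    rw [← intervalIntegral.integral_add (i1.intervalIntegrable _ _) (i2.intervalIntegrable _ _),
      ← intervalIntegral.integral_neg]
    refine intervalIntegral.integral_eq_sub_of_hasDerivAt
      (f := fun r => 1 / 2 * ‖steklov h v r‖ ^ 2 + 1 / 2 * ‖steklov h (fun r => G (u r)) r‖ ^ 2
        - inner ℝ (steklov h Γ r) (steklov h (fun r => G (u r)) r)) (fun r hr => ?_)
      ((i1.add i2).neg.intervalIntegrable _ _)
    rw [uIcc_of_le ht] at hr
    have d1 := ((hasDerivAt_steklov hv h r).norm_sq).const_mul (1 / 2 : ℝ)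
    have d2 := ((hasDerivAt_steklov hGu h r).norm_sq).const_mul (1 / 2 : ℝ)
    have d3 := (hasDerivAt_steklov hΓc h r).inner ℝ (hasDerivAt_steklov hGu h r)
    rw [← steklov_deriv hΓ'i hΓp] at d3
    refine ((d1.add d2).sub d3).congr_deriv ?_
    have e := hstep h hh r hr
    rw [real_inner_comm, inner_sub_left] at e
    linear_combination e
  have l1 := ((tendsto_integral_inner_steklov hFi hv ht).add
    (tendsto_integral_inner_steklov hΓ'i hGu ht)).neg
  have lE : ∀ s, Tendsto (fun h => 1 / 2 * ‖steklov h v s‖ ^ 2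
        + 1 / 2 * ‖steklov h (fun r => G (u r)) s‖ ^ 2
        - inner ℝ (steklov h Γ s) (steklov h (fun r => G (u r)) s)) (𝓝[>] 0)
      (𝓝 (1 / 2 * ‖v s‖ ^ 2 + 1 / 2 * ‖G (u s)‖ ^ 2 - inner ℝ (Γ s) (G (u s)))) := fun s =>
    ((((tendsto_steklov hv s).norm.pow 2).const_mul _).add
      (((tendsto_steklov hGu s).norm.pow 2).const_mul _)).sub
      ((tendsto_steklov hΓc s).inner (tendsto_steklov hGu s))
  have l3 := tendsto_nhds_unique (l1.congr' (by
    filter_upwards [Ioo_mem_nhdsGT (zero_lt_one' ℝ)] with h hh using key h hh))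
    ((lE t).sub (lE 0))
  rw [hΓγ t ⟨ht, by linarith⟩, hΓ0] at l3
  have l4 : ∫ r in (0 : ℝ)..t, (inner ℝ (f r) (v r) + inner ℝ (γ' r) (G (u r))) =
      ∫ r in (0 : ℝ)..t, (inner ℝ (F r) (v r) + inner ℝ (Γ' r) (G (u r))) := by
    refine intervalIntegral.integral_congr_ae (Eventually.of_forall fun r hr => ?_)
    rw [uIoc_of_le ht] at hr
    rw [hFf r ⟨hr.1, by linarith [hr.2]⟩, hΓ' r ⟨hr.1, by linarith [hr.2]⟩]
  rw [l4, intervalIntegral.integral_add]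
  · linarith
  · exact intervalIntegrable_inner (hFii _ _) hv.continuousOn
  · exact intervalIntegrable_inner hΓ'i.intervalIntegrable hGu.continuousOn

end Identities

/-! ### The memory kernel -/

section Kernel

variable {μ : ℝ → ℝ}

theorem IsMemoryKernel.intervalIntegrable_deriv (hμ : IsMemoryKernel μ) {a b : ℝ} (ha : 0 ≤ a)
    (hb : 0 ≤ b) : IntervalIntegrable (deriv μ) volume a b := by
  have h0 : ∀ c, 0 ≤ c → IntervalIntegrable (deriv μ) volume 0 c := fun c hc => by
    rcases hc.eq_or_lt with rfl | hc
    · simp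
    · exact (hμ.locallyAC c hc).intervalIntegrable_deriv
  exact (h0 a ha).symm.trans (h0 b hb)

theorem IsMemoryKernel.integral_deriv (hμ : IsMemoryKernel μ) {a b : ℝ} (ha : 0 ≤ a)
    (hb : 0 ≤ b) : ∫ s in a..b, deriv μ s = μ b - μ a := by
  have h0 : ∀ c, 0 ≤ c → ∫ s in (0 : ℝ)..c, deriv μ s = μ c - μ 0 := fun c hc => by
    rcases hc.eq_or_lt with rfl | hc
    · simp
    · exact (hμ.locallyAC c hc).integral_deriv_eq_sub
  rw [← intervalIntegral.integral_interval_sub_left (a := 0) (hμ.intervalIntegrable_deriv le_rfl hb)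
    (hμ.intervalIntegrable_deriv le_rfl ha), h0 b hb, h0 a ha]
  ring

theorem IsMemoryKernel.deriv_nonpos_ae (hμ : IsMemoryKernel μ) :
    ∀ᵐ s ∂(volume.restrict (Ioi (0 : ℝ))), deriv μ s ≤ 0 := by
  obtain ⟨α, hα, h⟩ := hμ.decay
  filter_upwards [h, ae_restrict_mem measurableSet_Ioi] with s hs hs0
  have := mul_nonneg hα.le (hμ.nonneg s (le_of_lt hs0))
  linarith

/-- Zeros of the kernel are minima, so `μ'` vanishes wherever the history is unconstrained. -/
theorem IsMemoryKernel.deriv_eq_zero (hμ : IsMemoryKernel μ) {s : ℝ} (hs : 0 < s) (h : μ s = 0) :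
    deriv μ s = 0 := by
  refine IsLocalMin.deriv_eq_zero ?_
  filter_upwards [Ioi_mem_nhds hs] with x hx
  rw [h]
  exact hμ.nonneg x (le_of_lt hx)

/-- The derivative of the kernel, extended by zero to the negative half-line. -/
def kernelDeriv (μ : ℝ → ℝ) : ℝ → ℝ := (Ioi 0).indicator (deriv μ)

/-- The kernel, extended by the constant `μ 0` to the negative half-line; it is a primitive of
`kernelDeriv μ`. -/
def extKernel (μ : ℝ → ℝ) (x : ℝ) : ℝ := μ (max x 0)

theorem measurable_kernelDeriv (μ : ℝ → ℝ) : Measurable (kernelDeriv μ) :=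
  (measurable_deriv μ).indicator measurableSet_Ioi

theorem extKernel_of_nonneg {x : ℝ} (hx : 0 ≤ x) : extKernel μ x = μ x := by
  rw [extKernel, max_eq_left hx]

theorem extKernel_of_nonpos {x : ℝ} (hx : x ≤ 0) : extKernel μ x = μ 0 := by
  rw [extKernel, max_eq_right hx]

theorem IsMemoryKernel.kernelDeriv_nonpos_ae (hμ : IsMemoryKernel μ) :
    ∀ᵐ s, kernelDeriv μ s ≤ 0 := by
  filter_upwards [(ae_restrict_iff' measurableSet_Ioi).1 hμ.deriv_nonpos_ae] with s hs
  by_cases h : s ∈ Ioi (0 : ℝ)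
  · rw [kernelDeriv, indicator_of_mem h]; exact hs h
  · rw [kernelDeriv, indicator_of_notMem h]

theorem IsMemoryKernel.intervalIntegrable_kernelDeriv (hμ : IsMemoryKernel μ) (a b : ℝ) :
    IntervalIntegrable (kernelDeriv μ) volume a b := by
  have h : ∀ c, IntervalIntegrable (kernelDeriv μ) volume 0 c := fun c => by
    rcases le_total 0 c with hc | hc
    · refine (hμ.intervalIntegrable_deriv le_rfl hc).congr_uIoo fun s hs => ?_
      rw [uIoo_of_le hc] at hs
      exact (indicator_of_mem (s := Ioi 0) hs.1 _).symm
    · refine IntervalIntegrable.congr_uIoo (f := fun _ => (0 : ℝ)) (by simp) fun s hs => ?_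
      rw [uIoo_of_ge hc] at hs
      exact (indicator_of_notMem (s := Ioi 0) (not_lt.2 hs.2.le) _).symm
  exact (h a).symm.trans (h b)

theorem IsMemoryKernel.integral_kernelDeriv (hμ : IsMemoryKernel μ) (a b : ℝ) :
    ∫ s in a..b, kernelDeriv μ s = extKernel μ b - extKernel μ a := by
  have h : ∀ c, ∫ s in (0 : ℝ)..c, kernelDeriv μ s = extKernel μ c - μ 0 := fun c => by
    rcases le_total 0 c with hc | hc
    · rw [extKernel_of_nonneg hc, ← hμ.integral_deriv le_rfl hc]
      refine intervalIntegral.integral_congr_ae (Eventually.of_forall fun s hs => ?_)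
      rw [uIoc_of_le hc] at hs
      exact indicator_of_mem (s := Ioi 0) hs.1 _
    · rw [extKernel_of_nonpos hc, sub_self]
      refine intervalIntegral.integral_zero_ae (Eventually.of_forall fun s hs => ?_)
      rw [uIoc_of_ge hc] at hs
      exact indicator_of_notMem (s := Ioi 0) (not_lt.2 hs.2) _
  rw [← intervalIntegral.integral_interval_sub_left (hμ.intervalIntegrable_kernelDeriv 0 b)
    (hμ.intervalIntegrable_kernelDeriv 0 a), h a, h b]
  ring

theorem IsMemoryKernel.integral_norm_kernelDeriv (hμ : IsMemoryKernel μ) (a b : ℝ) :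
    ∫ s in a..b, ‖kernelDeriv μ s‖ = extKernel μ a - extKernel μ b := by
  rw [← neg_sub (extKernel μ b), ← hμ.integral_kernelDeriv a b, ← intervalIntegral.integral_neg]
  refine intervalIntegral.integral_congr_ae ?_
  filter_upwards [hμ.kernelDeriv_nonpos_ae] with s hs _
  rw [Real.norm_of_nonpos hs]

theorem IsMemoryKernel.antitone_extKernel (hμ : IsMemoryKernel μ) : Antitone (extKernel μ) := by
  intro a b hab
  rw [← sub_nonneg, ← hμ.integral_norm_kernelDeriv]
  exact intervalIntegral.integral_nonneg hab fun _ _ => norm_nonneg _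

theorem IsMemoryKernel.antitone (hμ : IsMemoryKernel μ) {a b : ℝ} (ha : 0 ≤ a) (hab : a ≤ b) :
    μ b ≤ μ a := by
  rw [← extKernel_of_nonneg (μ := μ) ha, ← extKernel_of_nonneg (μ := μ) (ha.trans hab)]
  exact hμ.antitone_extKernel hab

theorem IsMemoryKernel.extKernel_nonneg (hμ : IsMemoryKernel μ) (x : ℝ) : 0 ≤ extKernel μ x :=
  hμ.nonneg _ (le_max_right _ _)

/-- From monotonicity and integrability, `s μ(s) ≤ ∫ μ`. -/
theorem IsMemoryKernel.tendsto_zero (hμ : IsMemoryKernel μ) : Tendsto μ atTop (𝓝 0) := by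
  have h : ∀ s, 0 < s → μ s ≤ (∫ s in Ioi 0, μ s) * s⁻¹ := fun s hs => by
    rw [← div_eq_mul_inv, le_div_iff₀ hs]
    have h1 : ∫ _ in (0 : ℝ)..s, μ s ≤ ∫ x in (0 : ℝ)..s, μ x := by
      refine intervalIntegral.integral_mono_on hs.le (by simp) ?_ fun x hx =>
        hμ.antitone hx.1 hx.2
      exact (intervalIntegrable_iff_integrableOn_Ioc_of_le hs.le).2
        (hμ.integrable.mono_set Ioc_subset_Ioi_self)
    rw [intervalIntegral.integral_const, smul_eq_mul, sub_zero,
      intervalIntegral.integral_of_le hs.le] at h1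
    rw [mul_comm]
    refine h1.trans (setIntegral_mono_set hμ.integrable ?_ (ae_of_all _ Ioc_subset_Ioi_self))
    filter_upwards [ae_restrict_mem measurableSet_Ioi] with x hx using hμ.nonneg x (le_of_lt hx)
  have h0 : Tendsto (fun s : ℝ => (∫ s in Ioi 0, μ s) * s⁻¹) atTop (𝓝 0) := by
    simpa using tendsto_inv_atTop_zero.const_mul (∫ s in Ioi 0, μ s)
  exact squeeze_zero' (by filter_upwards [eventually_ge_atTop 0] with s hs using hμ.nonneg s hs)
    (by filter_upwards [eventually_gt_atTop 0] with s hs using h s hs) h0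

theorem IsMemoryKernel.integrableOn_deriv (hμ : IsMemoryKernel μ) :
    IntegrableOn (deriv μ) (Ioi 0) := by
  refine integrableOn_Ioi_of_intervalIntegral_norm_bounded (μ 0) 0
    (fun T : ℝ => ?_) tendsto_id ?_ (l := atTop)
  · rcases le_total 0 T with hT | hT
    · exact (intervalIntegrable_iff_integrableOn_Ioc_of_le hT).1
        (hμ.intervalIntegrable_deriv le_rfl hT)
    · simp [Ioc_eq_empty (not_lt.2 hT)]
  · filter_upwards [eventually_ge_atTop (0 : ℝ)] with T hT
    have e : ∫ s in (0 : ℝ)..T, ‖deriv μ s‖ = ∫ s in (0 : ℝ)..T, ‖kernelDeriv μ s‖ := by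
      refine intervalIntegral.integral_congr_ae (Eventually.of_forall fun s hs => ?_)
      rw [uIoc_of_le hT] at hs
      rw [kernelDeriv, indicator_of_mem (s := Ioi 0) hs.1]
    rw [id, e, hμ.integral_norm_kernelDeriv, extKernel_of_nonneg le_rfl]
    linarith [hμ.extKernel_nonneg T]

theorem IsMemoryKernel.integral_Ioi_deriv (hμ : IsMemoryKernel μ) {a : ℝ} (ha : 0 ≤ a) :
    ∫ s in Ioi a, deriv μ s = -μ a := by
  have h1 := intervalIntegral_tendsto_integral_Ioi a
    (hμ.integrableOn_deriv.mono_set (Ioi_subset_Ioi ha)) tendsto_id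
  have h2 : Tendsto (fun T : ℝ => ∫ s in a..T, deriv μ s) atTop (𝓝 (0 - μ a)) := by
    refine (hμ.tendsto_zero.sub_const (μ a)).congr' ?_
    filter_upwards [eventually_ge_atTop (0 : ℝ)] with T hT
    rw [hμ.integral_deriv ha hT]
  rw [tendsto_nhds_unique h1 h2, zero_sub]

end Kernel

/-! ### Memory integrals as functions of time -/

section Convolution

variable {E : Type*} [NormedAddCommGroup E] [NormedSpace ℝ E]

theorem indicator_smul_history (g : ℝ → ℝ) (X : ℝ → E) (t : ℝ) :
    (fun q => (Ioi 0).indicator g (t - q) • X q) =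
      fun q => (Ioi 0).indicator (fun s => g s • X (t - s)) (t - q) := by
  funext q
  by_cases h : t - q ∈ Ioi (0 : ℝ)
  · rw [indicator_of_mem h, indicator_of_mem h, sub_sub_cancel]
  · rw [indicator_of_notMem h, indicator_of_notMem h, zero_smul]

theorem integrableOn_history_iff {g : ℝ → ℝ} {X : ℝ → E} (t : ℝ) :
    IntegrableOn (fun s => g s • X (t - s)) (Ioi 0) ↔
      Integrable fun q => (Ioi 0).indicator g (t - q) • X q := by
  rw [indicator_smul_history, ← integrable_indicator_iff measurableSet_Ioi]
  refine ⟨fun h => h.comp_sub_left t, fun h => ?_⟩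
  have := h.comp_sub_left t
  simpa only [sub_sub_cancel] using this

theorem integral_history_eq {g : ℝ → ℝ} {X : ℝ → E} (t : ℝ) :
    ∫ s in Ioi 0, g s • X (t - s) = ∫ q, (Ioi 0).indicator g (t - q) • X q := by
  rw [indicator_smul_history, integral_sub_left_eq_self, integral_indicator measurableSet_Ioi]

/-- Functions of time whose history part is integrable against the memory kernel and which are
locally integrable for positive times. -/
structure HasHistory (μ : ℝ → ℝ) (X : ℝ → E) : Prop where
  aestronglyMeasurable : AEStronglyMeasurable X volume
  past : IntegrableOn (fun q => μ (-q) • X q) (Iio 0)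
  future : ∀ t, 0 ≤ t → IntegrableOn X (Ioc 0 t)

variable {μ : ℝ → ℝ} {X : ℝ → E}

theorem HasHistory.integrable_extKernel (hX : HasHistory μ X) {t : ℝ}
    (ht : 0 ≤ t) : Integrable fun q => extKernel μ (-q) • (Iio t).indicator X q := by
  have e : (fun q => extKernel μ (-q) • (Iio t).indicator X q) =
      (Iio t).indicator fun q => extKernel μ (-q) • X q := by
    funext q
    by_cases h : q ∈ Iio t
    · rw [indicator_of_mem h, indicator_of_mem h]
    · rw [indicator_of_notMem h, indicator_of_notMem h, smul_zero]
  rw [e, integrable_indicator_iff measurableSet_Iio]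
  have h1 : IntegrableOn (fun q => extKernel μ (-q) • X q) (Iio 0) :=
    hX.past.congr_fun (fun q hq => by
      rw [extKernel_of_nonneg (neg_nonneg.2 (le_of_lt hq))]) measurableSet_Iio
  have h2 : IntegrableOn (fun q => extKernel μ (-q) • X q) (Ioc 0 t) :=
    IntegrableOn.congr_fun ((hX.future t ht).smul (μ 0)) (fun q hq => by
      simp only [Pi.smul_apply]
      rw [extKernel_of_nonpos (neg_nonpos.2 hq.1.le)]) measurableSet_Ioc
  have h3 : IntegrableOn (fun q => extKernel μ (-q) • X q) {0} := by simp
  refine ((h1.union h2).union h3).mono_set fun q hq => ?_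
  rcases lt_trichotomy q 0 with h | h | h
  · exact Or.inl (Or.inl h)
  · exact Or.inr h
  · exact Or.inl (Or.inr ⟨h, le_of_lt hq⟩)

theorem HasHistory.integrableOn_memory (hμ : IsMemoryKernel μ) (hX : HasHistory μ X) {t : ℝ}
    (ht : 0 ≤ t) : IntegrableOn (fun s => μ s • X (t - s)) (Ioi 0) := by
  rw [integrableOn_history_iff]
  have e : (fun q => (Ioi 0).indicator μ (t - q) • X q) =
      fun q => (Ioi 0).indicator (extKernel μ) (t - q) • X q := by
    funext q
    by_cases h : t - q ∈ Ioi (0 : ℝ)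
    · rw [indicator_of_mem h, indicator_of_mem h, extKernel_of_nonneg (le_of_lt h)]
    · rw [indicator_of_notMem h, indicator_of_notMem h]
  rw [e]
  refine (hX.integrable_extKernel ht).mono ?_ (Eventually.of_forall fun q => ?_)
  · refine AEStronglyMeasurable.smul ?_ hX.aestronglyMeasurable
    exact ((hμ.antitone_extKernel.measurable.indicator measurableSet_Ioi).comp
      (measurable_const.sub measurable_id)).aestronglyMeasurable
  · by_cases h : t - q ∈ Ioi (0 : ℝ)
    · rw [indicator_of_mem h, indicator_of_mem (show q ∈ Iio t from sub_pos.1 (mem_Ioi.1 h)),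
        norm_smul,
        norm_smul, Real.norm_of_nonneg (hμ.extKernel_nonneg _),
        Real.norm_of_nonneg (hμ.extKernel_nonneg _)]
      exact mul_le_mul_of_nonneg_right (hμ.antitone_extKernel (by linarith)) (norm_nonneg _)
    · rw [indicator_of_notMem h, zero_smul, norm_zero]
      exact norm_nonneg _

/-- Since
`∫₀ᵗ |μ'(r - q)| dr = μ((-q)⁺) - μ((t-q)⁺) ≤ μ((-q)⁺)`, Fubini's theorem applies to
`μ'(r - q) X(q)`, although `μ'` is not controlled pointwise by `μ`. -/
theorem HasHistory.integrable_prod (hμ : IsMemoryKernel μ) (hX : HasHistory μ X) {t : ℝ}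
    (ht : 0 ≤ t) : Integrable (Function.uncurry fun r q => kernelDeriv μ (r - q) • X q)
      ((volume.restrict (Ioc 0 t)).prod volume) := by
  have hm : AEStronglyMeasurable (Function.uncurry fun r q => kernelDeriv μ (r - q) • X q)
      ((volume.restrict (Ioc 0 t)).prod volume) := by
    refine AEStronglyMeasurable.smul ?_ hX.aestronglyMeasurable.comp_snd
    exact ((measurable_kernelDeriv μ).comp
      (measurable_fst.sub measurable_snd)).aestronglyMeasurable
  have hi : ∀ q, IntervalIntegrable (fun r => kernelDeriv μ (r - q)) volume 0 t := fun q => by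
    have := (hμ.intervalIntegrable_kernelDeriv (0 - q) (t - q)).comp_sub_right q
    simpa using this
  refine (integrable_prod_iff' hm).2 ⟨Eventually.of_forall fun q => ?_, ?_⟩
  · exact ((intervalIntegrable_iff_integrableOn_Ioc_of_le ht).1 (hi q)).smul_const (X q)
  · have hval : ∀ q, ∫ r, ‖Function.uncurry (fun r q => kernelDeriv μ (r - q) • X q) (r, q)‖
        ∂(volume.restrict (Ioc 0 t)) = (extKernel μ (-q) - extKernel μ (t - q)) * ‖X q‖ := by
      intro q
      simp only [Function.uncurry_apply_pair, norm_smul]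
      rw [integral_mul_const, ← intervalIntegral.integral_of_le ht,
        intervalIntegral.integral_comp_sub_right (fun x => ‖kernelDeriv μ x‖),
        hμ.integral_norm_kernelDeriv, zero_sub]
    simp only [hval]
    refine (hX.integrable_extKernel ht).mono ?_ (Eventually.of_forall fun q => ?_)
    · refine AEStronglyMeasurable.mul ?_ hX.aestronglyMeasurable.norm
      exact ((hμ.antitone_extKernel.measurable.comp measurable_neg).sub
        (hμ.antitone_extKernel.measurable.comp
          (measurable_const.sub measurable_id))).aestronglyMeasurable
    · have h0 : 0 ≤ extKernel μ (-q) - extKernel μ (t - q) :=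
        sub_nonneg.2 (hμ.antitone_extKernel (by linarith))
      by_cases h : q ∈ Iio t
      · rw [indicator_of_mem h, norm_smul, norm_mul, norm_norm, Real.norm_of_nonneg h0,
          Real.norm_of_nonneg (hμ.extKernel_nonneg _)]
        exact mul_le_mul_of_nonneg_right (by linarith [hμ.extKernel_nonneg (t - q)])
          (norm_nonneg _)
      · have hq : t ≤ q := not_lt.1 h
        rw [extKernel_of_nonpos (by linarith), extKernel_of_nonpos (by linarith), sub_self,
          zero_mul, norm_zero]
        exact norm_nonneg _

theorem HasHistory.ae_integrableOn_deriv (hμ : IsMemoryKernel μ) (hX : HasHistory μ X) :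
    ∀ᵐ r ∂(volume.restrict (Ioi (0 : ℝ))),
      IntegrableOn (fun s => deriv μ s • X (r - s)) (Ioi 0) := by
  have h : ∀ n : ℕ, ∀ᵐ r ∂(volume.restrict (Ioc (0 : ℝ) n)),
      IntegrableOn (fun s => deriv μ s • X (r - s)) (Ioi 0) := fun n => by
    filter_upwards [(hX.integrable_prod hμ n.cast_nonneg).prod_right_ae] with r hr
    rw [integrableOn_history_iff]
    exact hr
  have hU : (⋃ n : ℕ, Ioc (0 : ℝ) n) = Ioi 0 := by
    ext x
    simp only [mem_Ioi, mem_iUnion, mem_Ioc]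
    exact ⟨fun ⟨_, hx, _⟩ => hx, fun hx => (exists_nat_ge x).imp fun n hn => ⟨hx, hn⟩⟩
  rw [← ae_restrict_iUnion_iff, hU] at h
  exact h

theorem HasHistory.integrableOn_integral_deriv (hμ : IsMemoryKernel μ) (hX : HasHistory μ X)
    {t : ℝ} (ht : 0 ≤ t) :
    IntegrableOn (fun r => ∫ s in Ioi 0, deriv μ s • X (r - s)) (Ioc 0 t) := by
  simp only [integral_history_eq]
  exact (hX.integrable_prod hμ ht).integral_prod_left

/-- Memory terms are absolutely continuous in time:
`d/dt ∫₀^∞ μ(s) X(t-s) ds = μ(0) X(t) + ∫₀^∞ μ'(s) X(t-s) ds`, without any regularity of `X`. -/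
theorem HasHistory.memory_eq [CompleteSpace E] (hμ : IsMemoryKernel μ) (hX : HasHistory μ X)
    {t : ℝ} (ht : 0 ≤ t) :
    ∫ s in Ioi 0, μ s • X (t - s) = (∫ s in Ioi 0, μ s • X (0 - s)) +
      ∫ r in (0 : ℝ)..t, (μ 0 • X r + ∫ s in Ioi 0, deriv μ s • X (r - s)) := by
  have hfut := hX.future t ht
  have i1 := (integrableOn_history_iff t).1 (hX.integrableOn_memory hμ ht)
  have i2 := (integrableOn_history_iff 0).1 (hX.integrableOn_memory hμ le_rfl)
  have i3 : Integrable ((Ioc 0 t).indicator fun q => μ 0 • X q) :=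
    (integrable_indicator_iff measurableSet_Ioc).2 (hfut.smul (μ 0))
  rw [intervalIntegral.integral_of_le ht, integral_add (f := fun r => μ 0 • X r)
    (hfut.smul (μ 0)) (hX.integrableOn_integral_deriv hμ ht)]
  simp only [integral_history_eq]
  have swap := integral_integral_swap (hX.integrable_prod hμ ht)
  simp only [kernelDeriv] at swap
  rw [swap]
  -- after the exchange, integrating `μ'(r - q)` in `r` gives `μ((t-q)⁺) - μ((-q)⁺)`
  have hkernel : ∀ q, ∫ r in Ioc 0 t, (Ioi 0).indicator (deriv μ) (r - q) • X q =
      (extKernel μ (t - q) - extKernel μ (-q)) • X q := fun q => by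
    rw [integral_smul_const, ← intervalIntegral.integral_of_le ht,
      intervalIntegral.integral_comp_sub_right, ← zero_sub q, ← hμ.integral_kernelDeriv]
    rfl
  simp only [hkernel]
  rw [← integral_indicator measurableSet_Ioc, ← sub_eq_iff_eq_add', ← sub_eq_iff_eq_add',
    ← integral_sub i1 i2, ← integral_sub (f := fun q => _ - _) (i1.sub i2) i3]
  refine integral_congr_ae ?_
  have n0 : ∀ᵐ q : ℝ, q ≠ 0 := by simp [ae_iff]
  have nt : ∀ᵐ q : ℝ, q ≠ t := by simp [ae_iff]
  filter_upwards [n0, nt] with q h0 h1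
  rcases lt_or_gt_of_ne h0 with h0 | h0
  · rw [indicator_of_mem (s := Ioi 0) (show t - q ∈ Ioi (0 : ℝ) from by rw [mem_Ioi]; linarith),
      indicator_of_mem (s := Ioi 0) (show 0 - q ∈ Ioi (0 : ℝ) from by rw [mem_Ioi]; linarith),
      indicator_of_notMem (s := Ioc 0 t) (fun h => absurd h.1 (not_lt.2 h0.le)), sub_zero,
      extKernel_of_nonneg (by linarith), extKernel_of_nonneg (by linarith), sub_smul, zero_sub]
  · rw [indicator_of_notMem (s := Ioi 0) (show 0 - q ∉ Ioi (0 : ℝ) from by rw [mem_Ioi]; linarith),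
      zero_smul, sub_zero, extKernel_of_nonpos (show -q ≤ 0 by linarith)]
    rcases lt_or_gt_of_ne h1 with h1 | h1
    · rw [indicator_of_mem (s := Ioi 0) (show t - q ∈ Ioi (0 : ℝ) from by rw [mem_Ioi]; linarith),
        indicator_of_mem (s := Ioc 0 t) ⟨h0, h1.le⟩, extKernel_of_nonneg (by linarith), sub_smul]
    · rw [indicator_of_notMem (s := Ioi 0)
          (show t - q ∉ Ioi (0 : ℝ) from by rw [mem_Ioi]; linarith),
        indicator_of_notMem (s := Ioc 0 t) (fun h => absurd h.2 (not_le.2 h1)),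
        extKernel_of_nonpos (by linarith), zero_smul, sub_zero, sub_self, zero_smul]

theorem HasHistory.intervalIntegrable_memory_deriv (hμ : IsMemoryKernel μ) (hX : HasHistory μ X)
    {t : ℝ} (ht : 0 ≤ t) : IntervalIntegrable
      (fun r => μ 0 • X r + ∫ s in Ioi 0, deriv μ s • X (r - s)) volume 0 t :=
  (intervalIntegrable_iff_integrableOn_Ioc_of_le ht).2
    (((hX.future t ht).smul (μ 0)).add (hX.integrableOn_integral_deriv hμ ht))

theorem continuousOn_of_primitive {a a' : ℝ → E}
    (ha' : ∀ t, 0 ≤ t → IntervalIntegrable a' volume 0 t)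
    (ha : ∀ t, 0 ≤ t → a t = a 0 + ∫ r in (0 : ℝ)..t, a' r) : ContinuousOn a (Ici 0) := by
  intro t ht
  have ht1 : (0 : ℝ) ≤ t + 1 := by linarith [show (0 : ℝ) ≤ t from ht]
  have h1 : ContinuousOn (fun s => a 0 + ∫ r in (0 : ℝ)..s, a' r) (Icc 0 (t + 1)) := by
    refine continuousOn_const.add ?_
    have := intervalIntegral.continuousOn_primitive_interval (μ := volume) (f := a') (a := 0)
      (b := t + 1) (by
        rw [uIcc_of_le ht1, integrableOn_Icc_iff_integrableOn_Ioc]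
        exact (intervalIntegrable_iff_integrableOn_Ioc_of_le ht1).1 (ha' _ ht1))
    rwa [uIcc_of_le ht1] at this
  have h2 : ContinuousOn a (Icc 0 (t + 1)) := h1.congr fun s hs => ha s hs.1
  refine (h2 t ⟨ht, by linarith⟩).mono_of_mem_nhdsWithin ?_
  filter_upwards [self_mem_nhdsWithin,
    mem_nhdsWithin_of_mem_nhds (Iio_mem_nhds (lt_add_one t))] with s hs hs'
  exact ⟨hs, le_of_lt hs'⟩

theorem HasHistory.continuousOn_memory [CompleteSpace E] (hμ : IsMemoryKernel μ)
    (hX : HasHistory μ X) :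
    ContinuousOn (fun t => ∫ s in Ioi 0, μ s • X (t - s)) (Ici 0) :=
  continuousOn_of_primitive (fun _ ht => hX.intervalIntegrable_memory_deriv hμ ht)
    fun _ ht => hX.memory_eq hμ ht

end Convolution

/-! ### Histories that are square integrable against the kernel -/

section History

variable {E : Type*} [NormedAddCommGroup E] [NormedSpace ℝ E] {μ : ℝ → ℝ}

/-- The function `X` with its past set to zero where the kernel vanishes. Unlike `X` itself, which
is unconstrained there, it is measurable; memory integrals do not see the difference. -/
def cutHistory (μ : ℝ → ℝ) (X : ℝ → E) (q : ℝ) : E :=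
  if 0 ≤ q then X q else (μ (-q))⁻¹ • μ (-q) • X q

theorem cutHistory_of_nonneg {X : ℝ → E} {q : ℝ} (hq : 0 ≤ q) : cutHistory μ X q = X q :=
  if_pos hq

theorem cutHistory_of_ne_zero {X : ℝ → E} {q : ℝ} (h : μ (-q) ≠ 0) : cutHistory μ X q = X q := by
  rw [cutHistory, inv_smul_smul₀ h, ite_self]

theorem smul_cutHistory_neg {X : ℝ → E} (q : ℝ) :
    μ (-q) • cutHistory μ X q = μ (-q) • X q := by
  rcases eq_or_ne (μ (-q)) 0 with h | h
  · rw [h, zero_smul, zero_smul]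
  · rw [cutHistory_of_ne_zero h]

/-- The kernel being non-increasing, `μ s ≠ 0` implies `μ (s - t) ≠ 0`, so cutting the past where
`μ` vanishes does not change `X (t - s)`. -/
theorem IsMemoryKernel.cutHistory_sub (hμ : IsMemoryKernel μ) {X : ℝ → E} {t s : ℝ} (ht : 0 ≤ t)
    (hs : 0 < s) (h : μ s ≠ 0) : cutHistory μ X (t - s) = X (t - s) := by
  rcases le_or_gt 0 (t - s) with h0 | h0
  · exact cutHistory_of_nonneg h0
  · refine cutHistory_of_ne_zero (ne_of_gt ?_)
    have h1 : 0 < μ s := (hμ.nonneg s hs.le).lt_of_ne h.symm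
    exact h1.trans_le (hμ.antitone (by linarith) (by linarith))

theorem memoryMeasure_isFinite (hμ : IsMemoryKernel μ) : IsFiniteMeasure (memoryMeasure μ) :=
  isFiniteMeasure_withDensity_ofReal hμ.integrable.hasFiniteIntegral

theorem IsMemoryKernel.integrable_memoryMeasure_iff (hμ : IsMemoryKernel μ) {g : ℝ → E} :
    Integrable g (memoryMeasure μ) ↔ IntegrableOn (fun s => μ s • g s) (Ioi 0) := by
  rw [memoryMeasure, integrable_withDensity_iff_integrable_smul₀'
    hμ.integrable.aestronglyMeasurable.aemeasurable.ennreal_ofReal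
    (Eventually.of_forall fun _ => ENNReal.ofReal_lt_top)]
  refine integrableOn_congr_fun (fun s hs => ?_) measurableSet_Ioi
  rw [ENNReal.toReal_ofReal (hμ.nonneg s (le_of_lt hs))]

theorem IsMemoryKernel.integrableOn_past (hμ : IsMemoryKernel μ) {g : ℝ → E}
    (hg : Integrable (fun s => g (-s)) (memoryMeasure μ)) :
    IntegrableOn (fun q => μ (-q) • g q) (Iio 0) := by
  have h := hμ.integrable_memoryMeasure_iff.1 hg
  have h' : IntegrableOn (fun s => μ s • g (0 - s)) (Ioi 0) := by simpa only [zero_sub] using h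
  rw [integrableOn_history_iff] at h'
  refine h'.integrableOn.congr_fun (s := Iio 0) (fun q hq => ?_) measurableSet_Iio
  simp only
  rw [zero_sub, indicator_of_mem (show -q ∈ Ioi (0 : ℝ) from neg_pos.2 (mem_Iio.1 hq))]

/-- Functions of time that are square integrable against the memory kernel in the past and
continuous for nonnegative times. -/
structure IsL2History (μ : ℝ → ℝ) (X : ℝ → E) : Prop where
  continuousOn : ContinuousOn X (Ici 0)
  memLp : MemLp (fun s => X (-s)) 2 (memoryMeasure μ)

theorem IsL2History.aestronglyMeasurable (hμ : IsMemoryKernel μ) {X : ℝ → E}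
    (hX : IsL2History μ X) : AEStronglyMeasurable (cutHistory μ X) volume := by
  have := memoryMeasure_isFinite hμ
  have h1 : AEStronglyMeasurable (cutHistory μ X) (volume.restrict (Ici 0)) := by
    refine (hX.continuousOn.aestronglyMeasurable measurableSet_Ici).congr ?_
    filter_upwards [ae_restrict_mem measurableSet_Ici] with q hq
    exact (cutHistory_of_nonneg hq).symm
  have h2 : AEStronglyMeasurable (cutHistory μ X) (volume.restrict (Iio 0)) := by
    have h3 := (hμ.integrableOn_past (hX.memLp.integrable (by norm_num))).aestronglyMeasurable
    have h4 : AEStronglyMeasurable (fun q => (extKernel μ (-q))⁻¹) (volume.restrict (Iio 0)) :=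
      (hμ.antitone_extKernel.measurable.comp measurable_neg).inv.aestronglyMeasurable
    refine (h4.smul h3).congr ?_
    filter_upwards [ae_restrict_mem measurableSet_Iio] with q hq
    rw [Pi.smul_apply', extKernel_of_nonneg (neg_nonneg.2 (le_of_lt hq)), cutHistory,
      if_neg (not_le.2 hq)]
  have h3 := aestronglyMeasurable_union_iff.2 ⟨h2, h1⟩
  rwa [Iio_union_Ici, Measure.restrict_univ] at h3

theorem IsL2History.hasHistory (hμ : IsMemoryKernel μ) {X : ℝ → E} (hX : IsL2History μ X) :
    HasHistory μ (cutHistory μ X) where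
  aestronglyMeasurable := hX.aestronglyMeasurable hμ
  past := by
    have := memoryMeasure_isFinite hμ
    simp only [smul_cutHistory_neg]
    exact hμ.integrableOn_past (hX.memLp.integrable (by norm_num))
  future t _ := by
    have h : IntegrableOn X (Ioc 0 t) :=
      ((hX.continuousOn.mono Icc_subset_Ici_self).integrableOn_Icc).mono_set Ioc_subset_Icc_self
    exact h.congr_fun (fun q hq => (cutHistory_of_nonneg hq.1.le).symm) measurableSet_Ioc

variable {W : Type*} [NormedAddCommGroup W] [InnerProductSpace ℝ W]

theorem IsL2History.hasHistory_inner (hμ : IsMemoryKernel μ) {X Y : ℝ → W} (hX : IsL2History μ X)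
    (hY : IsL2History μ Y) :
    HasHistory μ fun q => inner ℝ (cutHistory μ X q) (cutHistory μ Y q) where
  aestronglyMeasurable := (hX.aestronglyMeasurable hμ).inner (hY.aestronglyMeasurable hμ)
  past := by
    have h : Integrable (fun s => inner ℝ (X (-s)) (Y (-s))) (memoryMeasure μ) := by
      refine (hX.memLp.norm.integrable_mul hY.memLp.norm).mono'
        (hX.memLp.aestronglyMeasurable.inner hY.memLp.aestronglyMeasurable)
        (Eventually.of_forall fun s => norm_inner_le_norm _ _)
    refine (hμ.integrableOn_past (g := fun q => inner ℝ (X q) (Y q)) h).congr_fun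
      (fun q _ => ?_) measurableSet_Iio
    simp only [smul_eq_mul]
    rcases eq_or_ne (μ (-q)) 0 with h0 | h0
    · rw [h0, zero_mul, zero_mul]
    · rw [cutHistory_of_ne_zero h0, cutHistory_of_ne_zero h0]
  future t _ := by
    have h : IntegrableOn (fun q => inner ℝ (X q) (Y q)) (Ioc 0 t) :=
      (((hX.continuousOn.inner hY.continuousOn).mono Icc_subset_Ici_self).integrableOn_Icc).mono_set
        Ioc_subset_Icc_self
    refine h.congr_fun (fun q hq => ?_) measurableSet_Ioc
    simp only [cutHistory_of_nonneg hq.1.le]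

theorem IsL2History.hasHistory_norm_sq (hμ : IsMemoryKernel μ) {X : ℝ → W}
    (hX : IsL2History μ X) : HasHistory μ fun q => ‖cutHistory μ X q‖ ^ 2 := by
  simpa only [real_inner_self_eq_norm_sq] using hX.hasHistory_inner hμ hX

/-- Expansion of the square of the relative history under a weighted integral over the past. -/
theorem integral_mul_norm_sub_sq [CompleteSpace W] {g : ℝ → ℝ} {X : ℝ → W} {x : W}
    (h0 : IntegrableOn g (Ioi 0)) (h1 : IntegrableOn (fun s => g s • X s) (Ioi 0))
    (h2 : IntegrableOn (fun s => g s • ‖X s‖ ^ 2) (Ioi 0)) :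
    IntegrableOn (fun s => g s * ‖x - X s‖ ^ 2) (Ioi 0) ∧
      ∫ s in Ioi 0, g s * ‖x - X s‖ ^ 2 = (∫ s in Ioi 0, g s) * ‖x‖ ^ 2
        - 2 * inner ℝ (∫ s in Ioi 0, g s • X s) x + ∫ s in Ioi 0, g s • ‖X s‖ ^ 2 := by
  have e : (fun s => g s * ‖x - X s‖ ^ 2) =
      fun s => g s * ‖x‖ ^ 2 - 2 * inner ℝ x (g s • X s) + g s • ‖X s‖ ^ 2 := by
    funext s
    rw [norm_sub_sq_real, real_inner_smul_right, smul_eq_mul]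
    ring
  have i0 : IntegrableOn (fun s => g s * ‖x‖ ^ 2) (Ioi 0) := h0.mul_const _
  have i1 : IntegrableOn (fun s => 2 * inner ℝ x (g s • X s)) (Ioi 0) :=
    (h1.const_inner x).const_mul 2
  have i2 : IntegrableOn (fun s => g s * ‖x‖ ^ 2 - 2 * inner ℝ x (g s • X s)) (Ioi 0) := i0.sub i1
  rw [e]
  refine ⟨i2.add h2, ?_⟩
  rw [integral_add i2 h2, integral_sub i0 i1, integral_mul_const,
    integral_const_mul, integral_inner h1, real_inner_comm]

/-- Where `cutHistory` differs from the history, both the kernel and its derivative vanish. -/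
theorem IsMemoryKernel.weighted_eta_eq (hμ : IsMemoryKernel μ) {X : ℝ → W} {t s : ℝ} (ht : 0 ≤ t)
    (hs : 0 < s) :
    μ s * ‖X t - X (t - s)‖ ^ 2 = μ s * ‖X t - cutHistory μ X (t - s)‖ ^ 2 ∧
      deriv μ s * ‖X t - X (t - s)‖ ^ 2 = deriv μ s * ‖X t - cutHistory μ X (t - s)‖ ^ 2 := by
  rcases eq_or_ne (μ s) 0 with h | h
  · simp [h, hμ.deriv_eq_zero hs h]
  · rw [hμ.cutHistory_sub ht hs h]
    exact ⟨rfl, rfl⟩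

theorem IsL2History.integral_memory_norm_sq [CompleteSpace W] (hμ : IsMemoryKernel μ) {X : ℝ → W}
    (hX : IsL2History μ X) {t : ℝ} (ht : 0 ≤ t) :
    ∫ s in Ioi 0, μ s * ‖X t - X (t - s)‖ ^ 2 = (∫ s in Ioi 0, μ s) * ‖X t‖ ^ 2
      - 2 * inner ℝ (∫ s in Ioi 0, μ s • cutHistory μ X (t - s)) (X t)
      + ∫ s in Ioi 0, μ s • ‖cutHistory μ X (t - s)‖ ^ 2 := by
  rw [← (integral_mul_norm_sub_sq hμ.integrable ((hX.hasHistory hμ).integrableOn_memory hμ ht)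
    ((hX.hasHistory_norm_sq hμ).integrableOn_memory hμ ht)).2]
  exact setIntegral_congr_fun measurableSet_Ioi fun s hs => (hμ.weighted_eta_eq ht hs).1

theorem IsL2History.ae_integral_deriv_norm_sq [CompleteSpace W] (hμ : IsMemoryKernel μ)
    {X : ℝ → W} (hX : IsL2History μ X) : ∀ᵐ t ∂(volume.restrict (Ioi (0 : ℝ))),
      IntegrableOn (fun s => deriv μ s * ‖X t - X (t - s)‖ ^ 2) (Ioi 0) ∧
      ∫ s in Ioi 0, deriv μ s * ‖X t - X (t - s)‖ ^ 2 =
        (μ 0 * ‖X t‖ ^ 2 + ∫ s in Ioi 0, deriv μ s • ‖cutHistory μ X (t - s)‖ ^ 2)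
        - 2 * inner ℝ (μ 0 • X t + ∫ s in Ioi 0, deriv μ s • cutHistory μ X (t - s)) (X t) := by
  filter_upwards [(hX.hasHistory hμ).ae_integrableOn_deriv hμ,
    (hX.hasHistory_norm_sq hμ).ae_integrableOn_deriv hμ, ae_restrict_mem measurableSet_Ioi]
    with t h1 h2 ht
  obtain ⟨h3, h4⟩ := integral_mul_norm_sub_sq (x := X t) hμ.integrableOn_deriv h1 h2
  refine ⟨h3.congr_fun (fun s hs => (hμ.weighted_eta_eq (le_of_lt ht) hs).2.symm)
    measurableSet_Ioi, ?_⟩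
  rw [setIntegral_congr_fun measurableSet_Ioi fun s hs => (hμ.weighted_eta_eq (le_of_lt ht) hs).2,
    h4, hμ.integral_Ioi_deriv le_rfl, inner_add_left, real_inner_smul_left,
    real_inner_self_eq_norm_sq]
  ring

theorem IsL2History.intervalIntegrable_deriv_norm_sq [CompleteSpace W] (hμ : IsMemoryKernel μ)
    {X : ℝ → W} (hX : IsL2History μ X) {t : ℝ} (ht : 0 ≤ t) :
    IntervalIntegrable (fun r => ∫ s in Ioi 0, deriv μ s * ‖X r - X (r - s)‖ ^ 2) volume 0 t := by
  have i1 := (hX.hasHistory hμ).intervalIntegrable_memory_deriv hμ ht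
  have i2 := (hX.hasHistory_norm_sq hμ).intervalIntegrable_memory_deriv hμ ht
  have i3 := i2.sub ((intervalIntegrable_inner i1 ((hX.continuousOn.mono (by
    rw [uIcc_of_le ht]; exact Icc_subset_Ici_self)))).const_mul 2)
  refine i3.congr_ae ?_
  rw [uIoc_of_le ht]
  have := ae_restrict_of_ae_restrict_of_subset (show Ioc 0 t ⊆ Ioi 0 from fun _ h => h.1)
    (hX.ae_integral_deriv_norm_sq hμ)
  filter_upwards [this, ae_restrict_mem measurableSet_Ioc] with r hr hr0
  rw [hr.2, cutHistory_of_nonneg hr0.1.le, smul_eq_mul]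

/-- The part of the energy balance that involves the kernel only: `μ'` enters through the
derivatives of the two memory terms in the expansion of `½ ∫₀^∞ μ(s) ‖X(t) - X(t-s)‖² ds`. -/
theorem IsL2History.memory_balance [CompleteSpace W] (hμ : IsMemoryKernel μ) {X : ℝ → W}
    (hX : IsL2History μ X) {t : ℝ} (ht : 0 ≤ t) :
    ∫ s in Ioi 0, μ s • ‖cutHistory μ X (t - s)‖ ^ 2 =
      (∫ s in Ioi 0, μ s • ‖cutHistory μ X (0 - s)‖ ^ 2) +
      2 * (∫ r in (0 : ℝ)..t,
        inner ℝ (μ 0 • cutHistory μ X r + ∫ s in Ioi 0, deriv μ s • cutHistory μ X (r - s)) (X r)) +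
      ∫ r in (0 : ℝ)..t, ∫ s in Ioi 0, deriv μ s * ‖X r - X (r - s)‖ ^ 2 := by
  have i1 := (hX.hasHistory hμ).intervalIntegrable_memory_deriv hμ ht
  have i4 := (intervalIntegrable_inner i1 (hX.continuousOn.mono (by
    rw [uIcc_of_le ht]; exact Icc_subset_Ici_self))).const_mul 2
  rw [(hX.hasHistory_norm_sq hμ).memory_eq hμ ht, add_assoc,
    ← intervalIntegral.integral_const_mul,
    ← intervalIntegral.integral_add i4 (hX.intervalIntegrable_deriv_norm_sq hμ ht)]
  congr 1
  refine intervalIntegral.integral_congr_ae ?_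
  filter_upwards [(ae_restrict_iff' measurableSet_Ioi).1 (hX.ae_integral_deriv_norm_sq hμ)]
    with r hr hr0
  rw [uIoc_of_le ht] at hr0
  rw [(hr hr0.1).2, cutHistory_of_nonneg hr0.1.le, smul_eq_mul]
  ring

end History

/-! ### Memory dissipation of regular histories -/

section Regular

variable {E : Type*} [NormedAddCommGroup E] [NormedSpace ℝ E] {μ : ℝ → ℝ}

/-- Where the kernel is positive it is bounded below, so the past is locally integrable there. -/
theorem HasHistory.intervalIntegrable_sub (hμ : IsMemoryKernel μ) {X : ℝ → E}
    (hX : HasHistory μ X) {t s : ℝ} (ht : 0 ≤ t) (hs : 0 < s) (h : 0 < μ s) :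
    IntervalIntegrable (fun σ => X (t - σ)) volume 0 s := by
  have h1 : IntervalIntegrable X volume (t - s) t := by
    rw [intervalIntegrable_iff_integrableOn_Ioo_of_le (by linarith)]
    have h2 := (hX.integrable_extKernel (μ := μ) ht).integrableOn (s := Ioo (t - s) t)
    refine (h2.norm.const_mul (μ s)⁻¹).mono' hX.aestronglyMeasurable.restrict ?_
    filter_upwards [ae_restrict_mem measurableSet_Ioo] with q hq
    rw [indicator_of_mem (show q ∈ Iio t from hq.2), norm_smul,
      Real.norm_of_nonneg (hμ.extKernel_nonneg _), ← mul_assoc, inv_mul_eq_div]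
    have h3 : μ s ≤ extKernel μ (-q) := by
      rw [← extKernel_of_nonneg (μ := μ) hs.le]
      exact hμ.antitone_extKernel (by linarith [hq.1])
    exact le_mul_of_one_le_left (norm_nonneg _) ((one_le_div h).2 h3)
  have h2 := h1.comp_sub_left t
  simpa using h2.symm

/-- The relative history `X(t) - X(t-s)` of a function with derivative `Y` on `[0, ∞)` and past
`X(-s) = X(0) - ∫₀^s Y(-r) dr`. -/
theorem sub_eq_integral_cutHistory [CompleteSpace E] (hμ : IsMemoryKernel μ) {X Y : ℝ → E}
    (hY : IsL2History μ Y) (hder : ∀ t, 0 ≤ t → HasDerivWithinAt X (Y t) (Ici 0) t)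
    (hpast : ∀ s, 0 < s → 0 < μ s → X (-s) = X 0 - ∫ r in (0 : ℝ)..s, Y (-r))
    {t s : ℝ} (ht : 0 ≤ t) (hs : 0 < s) (h : 0 < μ s) :
    X t - X (t - s) = ∫ σ in (0 : ℝ)..s, cutHistory μ Y (t - σ) := by
  have ftc : ∀ a b, 0 ≤ a → a ≤ b → X b - X a = ∫ q in a..b, cutHistory μ Y q := by
    intro a b ha hab
    have hsub : Icc a b ⊆ Ici 0 := fun x hx => ha.trans hx.1
    have e : ∫ q in a..b, cutHistory μ Y q = ∫ q in a..b, Y q := by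
      refine intervalIntegral.integral_congr fun q hq => ?_
      rw [uIcc_of_le hab] at hq
      exact cutHistory_of_nonneg (ha.trans hq.1)
    rw [e, intervalIntegral.integral_eq_sub_of_hasDeriv_right_of_le hab
      (fun x hx => ((hder x (hsub hx)).continuousWithinAt).mono hsub)
      (fun x hx => ((hder x (hsub (Ioo_subset_Icc_self hx))).mono
        (fun y hy => (hsub (Ioo_subset_Icc_self hx)).out.trans (le_of_lt hy))))
      ((hY.continuousOn.mono (by rwa [uIcc_of_le hab])).intervalIntegrable)]
  rw [intervalIntegral.integral_comp_sub_left (fun q => cutHistory μ Y q), sub_zero]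
  rcases le_or_gt s t with hst | hst
  · exact ftc _ _ (by linarith) (by linarith)
  · have hm : 0 < μ (s - t) := h.trans_le (hμ.antitone (by linarith) (by linarith))
    have h1 := hpast (s - t) (by linarith) hm
    have h2 : ∫ r in (0 : ℝ)..(s - t), Y (-r) = ∫ q in (t - s)..0, cutHistory μ Y q := by
      have e : ∫ r in (0 : ℝ)..(s - t), Y (-r) =
          ∫ r in (0 : ℝ)..(s - t), cutHistory μ Y (-r) := by
        refine intervalIntegral.integral_congr_ae (Eventually.of_forall fun r hr => ?_)
        rw [uIoc_of_le (by linarith)] at hr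
        refine (cutHistory_of_ne_zero (ne_of_gt (hm.trans_le ?_))).symm
        rw [neg_neg]
        exact hμ.antitone hr.1.le hr.2
      rw [e, intervalIntegral.integral_comp_neg (fun q => cutHistory μ Y q), neg_zero, neg_sub]
    rw [neg_sub, h2] at h1
    have i1 : IntervalIntegrable (cutHistory μ Y) volume (t - s) 0 := by
      have := (hY.hasHistory hμ).intervalIntegrable_sub hμ le_rfl (s := s - t) (by linarith) hm
      have := this.comp_sub_left 0
      simpa using this.symm
    have i2 : IntervalIntegrable (cutHistory μ Y) volume 0 t :=
      (intervalIntegrable_iff_integrableOn_Ioc_of_le ht).2 ((hY.hasHistory hμ).future t ht)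
    rw [← intervalIntegral.integral_add_adjacent_intervals i1 i2, ← ftc 0 t le_rfl ht, h1]
    abel

/-- Integration by parts against a memory kernel. -/
theorem IsMemoryKernel.integral_deriv_mul_primitive (hμ : IsMemoryKernel μ) {g : ℝ → ℝ}
    (hg : AEStronglyMeasurable g (volume.restrict (Ioi 0)))
    (hμg : IntegrableOn (fun s => μ s * g s) (Ioi 0)) :
    IntegrableOn (fun s => deriv μ s * ∫ σ in (0 : ℝ)..s, g σ) (Ioi 0) ∧
      ∫ s in Ioi 0, deriv μ s * (∫ σ in (0 : ℝ)..s, g σ) = -∫ s in Ioi 0, μ s * g s := by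
  set ν := volume.restrict (Ioi (0 : ℝ)) with hν
  -- write the primitive as an integral over `σ < s` and exchange the integrals
  set Ψ : ℝ → ℝ → ℝ := fun s σ => {p : ℝ × ℝ | p.2 < p.1}.indicator
    (fun p => deriv μ p.1 * g p.2) (s, σ) with hΨ
  have hm : AEStronglyMeasurable (Function.uncurry Ψ) (ν.prod ν) := by
    have : Function.uncurry Ψ = {p : ℝ × ℝ | p.2 < p.1}.indicator
      (fun p => deriv μ p.1 * g p.2) := by ext ⟨s, σ⟩; rfl
    rw [this]
    refine AEStronglyMeasurable.indicator ?_ (measurableSet_lt measurable_snd measurable_fst)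
    exact (((measurable_deriv μ).comp measurable_fst).aestronglyMeasurable).mul hg.comp_snd
  have hsec : ∀ σ, 0 < σ → (fun s => Ψ s σ) = (Ioi σ).indicator fun s => deriv μ s * g σ :=
    fun σ _ => by
      funext s
      by_cases h : σ < s
      · rw [indicator_of_mem (show s ∈ Ioi σ from h)]
        exact indicator_of_mem (s := {p : ℝ × ℝ | p.2 < p.1}) (a := (s, σ)) h _
      · rw [indicator_of_notMem (show s ∉ Ioi σ from h)]
        exact indicator_of_notMem (s := {p : ℝ × ℝ | p.2 < p.1}) (a := (s, σ)) h _
  have hsec' : ∀ s, 0 < s → (fun σ => Ψ s σ) = (Iio s).indicator fun σ => deriv μ s * g σ :=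
    fun s _ => by
      funext σ
      by_cases h : σ < s
      · rw [indicator_of_mem (show σ ∈ Iio s from h)]
        exact indicator_of_mem (s := {p : ℝ × ℝ | p.2 < p.1}) (a := (s, σ)) h _
      · rw [indicator_of_notMem (show σ ∉ Iio s from h)]
        exact indicator_of_notMem (s := {p : ℝ × ℝ | p.2 < p.1}) (a := (s, σ)) h _
  have hint : ∀ σ, 0 < σ → ∀ f : ℝ → ℝ, ∫ s, (Ioi σ).indicator f s ∂ν = ∫ s in Ioi σ, f s :=
    fun σ hσ f => by
      rw [integral_indicator measurableSet_Ioi, hν, Measure.restrict_restrict measurableSet_Ioi,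
        Ioi_inter_Ioi, sup_of_le_left hσ.le]
  have hprod : Integrable (Function.uncurry Ψ) (ν.prod ν) := by
    refine (integrable_prod_iff' hm).2 ⟨?_, ?_⟩
    · filter_upwards [ae_restrict_mem measurableSet_Ioi] with σ hσ
      simp only [Function.uncurry_apply_pair]
      rw [hsec σ hσ]
      exact (hμ.integrableOn_deriv.mul_const (g σ)).indicator measurableSet_Ioi
    · refine hμg.norm.congr ?_
      filter_upwards [ae_restrict_mem measurableSet_Ioi] with σ hσ
      simp only [Function.uncurry_apply_pair]
      have e : (fun s => ‖Ψ s σ‖) = (Ioi σ).indicator fun s => ‖deriv μ s‖ * ‖g σ‖ := by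
        funext s
        rw [congrFun (hsec σ hσ) s, norm_indicator_eq_indicator_norm]
        simp only [norm_mul]
      rw [e, hint σ hσ, integral_mul_const, norm_mul,
        Real.norm_of_nonneg (hμ.nonneg σ (le_of_lt hσ))]
      congr 1
      rw [← neg_neg (μ σ), ← hμ.integral_Ioi_deriv (le_of_lt hσ), ← integral_neg]
      refine integral_congr_ae ?_
      filter_upwards [ae_restrict_of_ae_restrict_of_subset (Ioi_subset_Ioi (le_of_lt hσ))
        hμ.deriv_nonpos_ae] with s hs
      rw [Real.norm_of_nonpos hs]
  have hin : ∀ᵐ s ∂ν, ∫ σ, Ψ s σ ∂ν = deriv μ s * ∫ σ in (0 : ℝ)..s, g σ := by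
    filter_upwards [ae_restrict_mem measurableSet_Ioi] with s hs
    rw [hsec' s hs, integral_indicator measurableSet_Iio, hν,
      Measure.restrict_restrict measurableSet_Iio, Iio_inter_Ioi, integral_const_mul,
      intervalIntegral.integral_of_le (le_of_lt hs), integral_Ioc_eq_integral_Ioo]
  refine ⟨hprod.integral_prod_left.congr hin, ?_⟩
  rw [← integral_congr_ae hin, integral_integral_swap hprod, ← integral_neg]
  refine integral_congr_ae ?_
  filter_upwards [ae_restrict_mem measurableSet_Ioi] with σ hσ
  rw [hsec σ hσ, hint σ hσ, integral_mul_const, hμ.integral_Ioi_deriv (le_of_lt hσ)]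
  ring

variable {W : Type*} [NormedAddCommGroup W] [InnerProductSpace ℝ W] [CompleteSpace W]

/-- For a regular history the memory dissipation is finite at every time and continuous: by parts,
`∫ μ'(s) ‖X(t) - X(t-s)‖² ds = -2 ∫ μ(s) ⟪X(t) - X(t-s), Y(t-s)⟫ ds`, and the right-hand side is
built from memory integrals of `Y` and `⟪X, Y⟫`. -/
theorem IsL2History.regular_dissipation (hμ : IsMemoryKernel μ) {X Y : ℝ → W}
    (hX : IsL2History μ X)
    (hY : IsL2History μ Y) (hder : ∀ t, 0 ≤ t → HasDerivWithinAt X (Y t) (Ici 0) t)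
    (hpast : ∀ s, 0 < s → 0 < μ s → X (-s) = X 0 - ∫ r in (0 : ℝ)..s, Y (-r)) :
    (∀ t, 0 ≤ t → IntegrableOn (fun s => deriv μ s * ‖X t - X (t - s)‖ ^ 2) (Ioi 0)) ∧
      ContinuousOn (fun t => ∫ s in Ioi 0, deriv μ s * ‖X t - X (t - s)‖ ^ 2) (Ici 0) := by
  have hYh := hY.hasHistory hμ
  have hXY := hX.hasHistory_inner hμ hY
  set g : ℝ → ℝ → ℝ := fun t σ =>
    2 * (inner ℝ (X t) (cutHistory μ Y (t - σ))
      - inner ℝ (cutHistory μ X (t - σ)) (cutHistory μ Y (t - σ))) with hg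
  have hgm : ∀ t, AEStronglyMeasurable (g t) (volume.restrict (Ioi 0)) := fun t => by
    have hq := (Measure.measurePreserving_sub_left volume t).quasiMeasurePreserving
    have hY' := hYh.aestronglyMeasurable.comp_quasiMeasurePreserving hq
    have hXY' := hXY.aestronglyMeasurable.comp_quasiMeasurePreserving hq
    exact (((aestronglyMeasurable_const (b := X t)).inner hY').sub hXY').const_mul 2 |>.restrict
  have hgi : ∀ t, 0 ≤ t → IntegrableOn (fun s => μ s * g t s) (Ioi 0) ∧
      ∫ s in Ioi 0, μ s * g t s = 2 * (inner ℝ (X t) (∫ s in Ioi 0, μ s • cutHistory μ Y (t - s))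
        - ∫ s in Ioi 0, μ s • inner ℝ (cutHistory μ X (t - s)) (cutHistory μ Y (t - s))) := by
    intro t ht
    have i1 := (hYh.integrableOn_memory hμ ht).const_inner (𝕜 := ℝ) (X t)
    have i2 := hXY.integrableOn_memory hμ ht
    have e : (fun s => μ s * g t s) = fun s => 2 * (inner ℝ (X t) (μ s • cutHistory μ Y (t - s))
        - μ s • inner ℝ (cutHistory μ X (t - s)) (cutHistory μ Y (t - s))) := by
      funext s
      rw [hg, real_inner_smul_right, smul_eq_mul]
      ring
    rw [e]
    refine ⟨(i1.sub i2).const_mul 2, ?_⟩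
    rw [integral_const_mul, integral_sub i1 i2, integral_inner (hYh.integrableOn_memory hμ ht)]
  have hsq : ∀ t, 0 ≤ t → ∀ s, 0 < s →
      deriv μ s * ‖X t - X (t - s)‖ ^ 2 = deriv μ s * ∫ σ in (0 : ℝ)..s, g t σ := by
    intro t ht s hs
    rcases (hμ.nonneg s hs.le).eq_or_lt with h | h
    · rw [hμ.deriv_eq_zero hs h.symm, zero_mul, zero_mul]
    · have hpos : ∀ σ ∈ Ioc 0 s, 0 < μ σ := fun σ hσ => h.trans_le (hμ.antitone hσ.1.le hσ.2)
      have hprim : ∀ σ ∈ Icc 0 s, (fun s => X t - X (t - s)) σ = (fun s => X t - X (t - s)) 0 +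
          ∫ r in (0 : ℝ)..σ, cutHistory μ Y (t - r) := fun σ hσ => by
        rcases hσ.1.eq_or_lt with h0 | h0
        · simp [← h0]
        · simp only [sub_zero, sub_self, zero_add]
          exact sub_eq_integral_cutHistory hμ hY hder hpast ht h0 (hpos σ ⟨h0, hσ.2⟩)
      have hint := hYh.intervalIntegrable_sub hμ ht hs h
      have h1 := inner_primitive hs.le hint hint hprim hprim
      simp only [sub_zero, sub_self, inner_zero_left, zero_add] at h1
      rw [← real_inner_self_eq_norm_sq, h1]
      congr 1
      refine intervalIntegral.integral_congr_ae (Eventually.of_forall fun σ hσ => ?_)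
      rw [uIoc_of_le hs.le] at hσ
      rw [real_inner_comm, hg]
      simp only
      rw [hμ.cutHistory_sub (X := X) ht hσ.1 (hpos σ hσ).ne', inner_sub_left]
      ring
  have hN : ∀ t, 0 ≤ t → IntegrableOn (fun s => deriv μ s * ‖X t - X (t - s)‖ ^ 2) (Ioi 0) ∧
      ∫ s in Ioi 0, deriv μ s * ‖X t - X (t - s)‖ ^ 2 =
        -(2 * (inner ℝ (X t) (∫ s in Ioi 0, μ s • cutHistory μ Y (t - s))
        - ∫ s in Ioi 0, μ s • inner ℝ (cutHistory μ X (t - s)) (cutHistory μ Y (t - s)))) := by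
    intro t ht
    obtain ⟨h1, h2⟩ := hμ.integral_deriv_mul_primitive (hgm t) (hgi t ht).1
    refine ⟨h1.congr_fun (fun s hs => (hsq t ht s hs).symm) measurableSet_Ioi, ?_⟩
    rw [setIntegral_congr_fun measurableSet_Ioi (hsq t ht), h2, (hgi t ht).2]
  refine ⟨fun t ht => (hN t ht).1, ?_⟩
  refine ContinuousOn.congr ?_ fun t ht => (hN t ht).2
  exact (((hX.continuousOn.inner (hYh.continuousOn_memory hμ)).sub
    (hXY.continuousOn_memory hμ)).const_smul (2 : ℝ)).neg

end Regular

/-! ### The delay term -/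

section Delay

variable {E : Type*} [NormedAddCommGroup E]

theorem intervalIntegrable_delay {w : ℝ → E} {τ : ℝ} (hτ : 0 < τ)
    (hw : ∀ t, 0 ≤ t → IntervalIntegrable w volume (-τ) t) {t : ℝ} (ht : 0 ≤ t) :
    IntervalIntegrable (fun r => w (r - τ)) volume 0 t := by
  have h1 : IntervalIntegrable w volume (-τ) (t - τ) := by
    refine (hw t ht).mono_set ?_
    rw [uIcc_of_le (by linarith), uIcc_of_le (by linarith)]
    exact Icc_subset_Icc_right (by linarith)
  simpa using h1.comp_sub_right τ

/-- The delay part of the energy is absolutely continuous in time, for a locally integrable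
past. -/
theorem delay_energy_eq {w : ℝ → ℝ} {τ : ℝ} (hτ : 0 < τ)
    (hw : ∀ t, 0 ≤ t → IntervalIntegrable w volume (-τ) t) :
    ContinuousOn (fun t => ∫ s in (t - τ)..t, Real.exp (-(t - s)) * w s) (Ici 0) ∧
    ∀ t, 0 ≤ t → ∫ s in (t - τ)..t, Real.exp (-(t - s)) * w s =
      (∫ s in (0 - τ)..0, Real.exp (-(0 - s)) * w s) +
        ∫ r in (0 : ℝ)..t, (w r - Real.exp (-τ) * w (r - τ)
          - ∫ s in (r - τ)..r, Real.exp (-(r - s)) * w s) := by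
  -- the weight factors: the delay energy is `exp(-t)` times a primitive of `y(r) - y(r-τ)`
  set y : ℝ → ℝ := fun s => Real.exp s * w s with hy
  have hyi : ∀ t, 0 ≤ t → IntervalIntegrable y volume (-τ) t := fun t ht =>
    (hw t ht).continuousOn_mul Real.continuous_exp.continuousOn
  have hyi0 : ∀ t, 0 ≤ t → IntervalIntegrable y volume 0 t := fun t ht =>
    (hyi 0 le_rfl).symm.trans (hyi t ht)
  have hyd : ∀ t, 0 ≤ t → IntervalIntegrable (fun r => y (r - τ)) volume 0 t := fun t ht =>
    intervalIntegrable_delay hτ hyi ht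
  set J : ℝ → ℝ := fun t => ∫ s in (t - τ)..t, y s with hJ
  have hZ : ∀ t, ∫ s in (t - τ)..t, Real.exp (-(t - s)) * w s = Real.exp (-t) * J t := fun t => by
    rw [hJ, ← intervalIntegral.integral_const_mul]
    refine intervalIntegral.integral_congr fun s _ => ?_
    simp only [hy]
    rw [← mul_assoc, ← Real.exp_add]
    congr 2
    ring
  have hJp : ∀ t, 0 ≤ t → J t = J 0 + ∫ r in (0 : ℝ)..t, (y r - y (r - τ)) := fun t ht => by
    have i1 : IntervalIntegrable y volume (-τ) (t - τ) := by
      refine (hyi t ht).mono_set ?_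
      rw [uIcc_of_le (by linarith), uIcc_of_le (by linarith)]
      exact Icc_subset_Icc_right (by linarith)
    have e1 := intervalIntegral.integral_add_adjacent_intervals i1 (i1.symm.trans (hyi t ht))
    have e2 := intervalIntegral.integral_add_adjacent_intervals (hyi 0 le_rfl) (hyi0 t ht)
    rw [intervalIntegral.integral_sub (hyi0 t ht) (hyd t ht),
      intervalIntegral.integral_comp_sub_right (fun r => y r)]
    simp only [hJ, zero_sub]
    linarith
  have hJc : ContinuousOn J (Ici 0) :=
    continuousOn_of_primitive (fun t ht => (hyi0 t ht).sub (hyd t ht)) hJp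
  have hexp : Continuous fun t : ℝ => Real.exp (-t) := Real.continuous_exp.comp continuous_neg
  refine ⟨?_, fun t ht => ?_⟩
  · simp only [hZ]
    exact hexp.continuousOn.mul hJc
  · have he : ∀ s : ℝ, Real.exp (-s) = Real.exp (-0) + ∫ r in (0 : ℝ)..s, -Real.exp (-r) := by
      intro s
      rw [intervalIntegral.integral_eq_sub_of_hasDerivAt (f := fun r => Real.exp (-r))
        (f' := fun r => -Real.exp (-r))
        (fun x _ => by simpa using (hasDerivAt_neg x).exp)
        ((hexp.neg : Continuous fun r : ℝ => -Real.exp (-r)).intervalIntegrable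
          _ _)]
      ring
    have h1 := inner_primitive (a := fun s : ℝ => Real.exp (-s)) (a' := fun s => -Real.exp (-s))
      (b := J) ht (hexp.neg.intervalIntegrable _ _) ((hyi0 t ht).sub (hyd t ht)) (fun s _ => he s)
      fun s hs => hJp s hs.1
    simp only [hZ]
    simp only [RCLike.inner_apply, conj_trivial] at h1
    rw [mul_comm (J t), mul_comm (J 0)] at h1
    refine h1.trans ?_
    congr 1
    refine intervalIntegral.integral_congr fun r _ => ?_
    simp only [hy]
    have e1 : Real.exp (-r) * Real.exp r = 1 := by rw [← Real.exp_add]; simp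
    have e2 : Real.exp (-r) * Real.exp (r - τ) = Real.exp (-τ) := by
      rw [← Real.exp_add]; congr 1; ring
    linear_combination w r * e1 - w (r - τ) * e2

end Delay

/-! ### The energy balance of the abstract problem -/

theorem integral_congr_of_nonneg {E : Type*} [NormedAddCommGroup E] [NormedSpace ℝ E] {t : ℝ}
    (ht : 0 ≤ t) {φ ψ : ℝ → E} (h : ∀ r, 0 ≤ r → φ r = ψ r) :
    ∫ r in (0 : ℝ)..t, φ r = ∫ r in (0 : ℝ)..t, ψ r := by
  refine intervalIntegral.integral_congr fun r hr => h r ?_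
  rw [uIcc_of_le ht] at hr
  exact hr.1

section EnergyFunctionals

variable {H : Type*} [NormedAddCommGroup H] {W : Type*} [NormedAddCommGroup W]
  {μ : ℝ → ℝ} {θ k τ : ℝ} {v : ℝ → H} {x : ℝ → W}

/-- The energy as a functional of the gradient `x` and the velocity `v`. -/
def historyEnergy (μ : ℝ → ℝ) (θ k τ : ℝ) (x : ℝ → W) (v : ℝ → H) (t : ℝ) : ℝ :=
  1 / 2 * ‖v t‖ ^ 2
    + (1 - ∫ s in Ioi 0, μ s) / 2 * ‖x t‖ ^ 2
    + 1 / 2 * (∫ s in Ioi 0, μ s * ‖x t - x (t - s)‖ ^ 2)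
    + θ * |k| * Real.exp τ / 2 * ∫ s in (t - τ)..t, Real.exp (-(t - s)) * ‖v s‖ ^ 2

/-- The bound for the derivative of the energy, as a functional of the gradient `x` and the
velocity `v`. -/
def historyDissipation (μ : ℝ → ℝ) (θ k τ : ℝ) (x : ℝ → W) (v : ℝ → H) (t : ℝ) : ℝ :=
  1 / 2 * (∫ s in Ioi 0, deriv μ s * ‖x t - x (t - s)‖ ^ 2)
    - |k| * (θ * Real.exp τ - 1) / 2 * ‖v t‖ ^ 2
    - |k| * (θ - 1) / 2 * ‖v (t - τ)‖ ^ 2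
    - θ * |k| * Real.exp τ / 2 * ∫ s in (t - τ)..t, Real.exp (-(t - s)) * ‖v s‖ ^ 2

theorem dissipation_nonpos (hμ : IsMemoryKernel μ) (hθ : 1 < θ) (hτ : 0 < τ) (t : ℝ) :
    historyDissipation μ θ k τ x v t ≤ 0 := by
  have h1 : ∫ s in Ioi 0, deriv μ s * ‖x t - x (t - s)‖ ^ 2 ≤ 0 := by
    refine integral_nonpos_of_ae ?_
    filter_upwards [hμ.deriv_nonpos_ae] with s hs
    exact mul_nonpos_of_nonpos_of_nonneg hs (sq_nonneg _)
  have h2 : 1 ≤ Real.exp τ := Real.one_le_exp hτ.le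
  have h3 : 0 ≤ θ * Real.exp τ - 1 := by nlinarith
  have h4 : 0 ≤ |k| * (θ * Real.exp τ - 1) / 2 * ‖v t‖ ^ 2 := by positivity
  have h5 : 0 ≤ |k| * (θ - 1) / 2 * ‖v (t - τ)‖ ^ 2 := by
    have : 0 ≤ θ - 1 := by linarith
    positivity
  have h6 : 0 ≤ θ * |k| * Real.exp τ / 2 *
      ∫ s in (t - τ)..t, Real.exp (-(t - s)) * ‖v s‖ ^ 2 := by
    refine mul_nonneg (by positivity) ?_
    exact intervalIntegral.integral_nonneg (by linarith) fun s _ => by positivity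
  rw [historyDissipation]
  linarith

variable [InnerProductSpace ℝ H]

/-- The derivative of the energy at almost every time, for solutions: the exact rate, before the
cross term `k ⟪v(t-τ), v(t)⟫` is estimated by Young's inequality. -/
def energyRate (μ : ℝ → ℝ) (θ k τ : ℝ) (x : ℝ → W) (v : ℝ → H) (t : ℝ) : ℝ :=
  1 / 2 * (∫ s in Ioi 0, deriv μ s * ‖x t - x (t - s)‖ ^ 2)
    - θ * |k| * Real.exp τ / 2 * ‖v t‖ ^ 2 - k * inner ℝ (v (t - τ)) (v t)
    - θ * |k| / 2 * ‖v (t - τ)‖ ^ 2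
    - θ * |k| * Real.exp τ / 2 * ∫ s in (t - τ)..t, Real.exp (-(t - s)) * ‖v s‖ ^ 2

theorem energyRate_le_dissipation (t : ℝ) :
    energyRate μ θ k τ x v t ≤ historyDissipation μ θ k τ x v t := by
  have h1 : -(k * inner ℝ (v (t - τ)) (v t)) ≤
      |k| * (1 / 2 * (‖v t‖ ^ 2 + ‖v (t - τ)‖ ^ 2)) := by
    refine (neg_le_abs _).trans ?_
    rw [abs_mul]
    refine mul_le_mul_of_nonneg_left ((abs_real_inner_le_norm _ _).trans ?_) (abs_nonneg k)
    nlinarith [sq_nonneg (‖v (t - τ)‖ - ‖v t‖)]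
  rw [energyRate, historyDissipation]
  linarith

end EnergyFunctionals

section Solution

variable {V : Type*} [NormedAddCommGroup V] [NormedSpace ℝ V]
  {H : Type*} [NormedAddCommGroup H] [InnerProductSpace ℝ H]
  {W : Type*} [NormedAddCommGroup W] [InnerProductSpace ℝ W]
  {T : V →L[ℝ] H} {G : V →L[ℝ] W} {μ : ℝ → ℝ} {θ k τ : ℝ} {u : ℝ → V} {v : ℝ → H}

/-- Solutions of the problem in abstract form, for the inclusion `T : V → H` and the gradient
`G : V → W`. -/
structure IsAbstractSolution (T : V →L[ℝ] H) (G : V →L[ℝ] W) (μ : ℝ → ℝ) (θ k τ : ℝ)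
    (u : ℝ → V) (v : ℝ → H) : Prop where
  continuousOn_u : ContinuousOn u (Ici 0)
  continuousOn_v : ContinuousOn v (Ici 0)
  hasDeriv_u : ∀ t, 0 ≤ t → HasDerivWithinAt (fun r => T (u r)) (v t) (Ici 0) t
  isL2History : IsL2History μ fun t => G (u t)
  history_v : MemLp v 2 (volume.restrict (Ioo (-τ) 0))
  equation : ∀ w : V, ∀ t, 0 ≤ t →
    inner ℝ (v t) (T w) - inner ℝ (v 0) (T w) +
      ∫ r in (0 : ℝ)..t,
        (inner ℝ (G (u r)) (G w)
          - (∫ s in Ioi 0, μ s * inner ℝ (G (u (r - s))) (G w))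
          + θ * |k| * Real.exp τ * inner ℝ (v r) (T w)
          + k * inner ℝ (v (r - τ)) (T w)) = 0

theorem IsAbstractSolution.intervalIntegrable_v (hu : IsAbstractSolution T G μ θ k τ u v)
    (hτ : 0 < τ) {t : ℝ} (ht : 0 ≤ t) : IntervalIntegrable v volume (-τ) t := by
  have h1 : IntervalIntegrable v volume (-τ) 0 := by
    rw [intervalIntegrable_iff_integrableOn_Ioo_of_le (by linarith)]
    exact hu.history_v.integrable (by norm_num)
  refine h1.trans (ContinuousOn.intervalIntegrable (hu.continuousOn_v.mono ?_))
  rw [uIcc_of_le ht]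
  exact Icc_subset_Ici_self

theorem IsAbstractSolution.intervalIntegrable_v_sq (hu : IsAbstractSolution T G μ θ k τ u v)
    (hτ : 0 < τ) {t : ℝ} (ht : 0 ≤ t) : IntervalIntegrable (fun s => ‖v s‖ ^ 2) volume (-τ) t := by
  have h1 : IntervalIntegrable (fun s => ‖v s‖ ^ 2) volume (-τ) 0 := by
    rw [intervalIntegrable_iff_integrableOn_Ioo_of_le (by linarith)]
    exact (memLp_two_iff_integrable_sq_norm hu.history_v.aestronglyMeasurable).1 hu.history_v
  refine h1.trans (ContinuousOn.intervalIntegrable ((hu.continuousOn_v.norm.pow 2).mono ?_))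
  rw [uIcc_of_le ht]
  exact Icc_subset_Ici_self

theorem IsAbstractSolution.intervalIntegrable_damping (hτ : 0 < τ)
    (hu : IsAbstractSolution T G μ θ k τ u v) {t : ℝ} (ht : 0 ≤ t) :
    IntervalIntegrable (fun r => inner ℝ (v (r - τ)) (v r)) volume 0 t :=
  intervalIntegrable_inner (intervalIntegrable_delay hτ
      (fun _ ht => hu.intervalIntegrable_v hτ ht) ht) (hu.continuousOn_v.mono (by
    rw [uIcc_of_le ht]; exact Icc_subset_Ici_self))

theorem IsAbstractSolution.continuousOn_delay_velocity (hτ : 0 < τ)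
    (hu : IsAbstractSolution T G μ θ k τ u v)
    {a : ℝ → H} (ha : MemLp a 2 (volume.restrict (Ioo (-τ) 0)))
    (hv : ∀ t ∈ Icc (-τ) 0, v t = v 0 - ∫ r in t..(0 : ℝ), a r) :
    ContinuousOn (fun t => v (t - τ)) (Ici 0) := by
  have h1 : ContinuousOn v (Icc (-τ) 0) := by
    have hi : IntegrableOn a (uIcc 0 (-τ)) := by
      rw [uIcc_of_ge (by linarith), integrableOn_Icc_iff_integrableOn_Ioo]
      exact ha.integrable (by norm_num)
    have h2 := intervalIntegral.continuousOn_primitive_interval hi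
    rw [uIcc_of_ge (by linarith)] at h2
    refine (continuousOn_const.add h2).congr (f := fun t => v 0 + ∫ r in (0 : ℝ)..t, a r) ?_
    intro t ht
    rw [hv t ht, intervalIntegral.integral_symm, sub_neg_eq_add]
  have h3 := h1.union_of_isClosed hu.continuousOn_v isClosed_Icc isClosed_Ici
  refine h3.comp (continuousOn_id.sub continuousOn_const) fun t ht => ?_
  rcases le_total (t - τ) 0 with h | h
  · exact Or.inl ⟨show -τ ≤ t - τ by linarith [mem_Ici.1 ht], h⟩
  · exact Or.inr h

variable [CompleteSpace W]

theorem IsAbstractSolution.intervalIntegrable_energyRate (hμ : IsMemoryKernel μ) (hτ : 0 < τ)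
    (hu : IsAbstractSolution T G μ θ k τ u v) {t : ℝ} (ht : 0 ≤ t) :
    IntervalIntegrable (energyRate μ θ k τ (fun t => G (u t)) v) volume 0 t := by
  have hsub : uIcc 0 t ⊆ Ici 0 := by rw [uIcc_of_le ht]; exact Icc_subset_Ici_self
  have hw : ∀ t, 0 ≤ t → IntervalIntegrable (fun s => ‖v s‖ ^ 2) volume (-τ) t :=
    fun _ ht => hu.intervalIntegrable_v_sq hτ ht
  have i1 := hu.isL2History.intervalIntegrable_deriv_norm_sq hμ ht
  have i2 : IntervalIntegrable (fun s => ‖v s‖ ^ 2) volume 0 t :=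
    (hw 0 le_rfl).symm.trans (hw t ht)
  have i3 := hu.intervalIntegrable_damping hτ ht
  have i4 := intervalIntegrable_delay hτ hw ht
  have i5 := ((delay_energy_eq hτ hw).1.mono hsub).intervalIntegrable (μ := volume)
  have := ((((i1.const_mul (1 / 2)).sub (i2.const_mul (θ * |k| * Real.exp τ / 2))).sub
    (i3.const_mul k)).sub (i4.const_mul (θ * |k| / 2))).sub
      (i5.const_mul (θ * |k| * Real.exp τ / 2))
  exact this

/-- Strong solutions: all terms of the energy rate are finite at every time and continuous. -/
theorem IsAbstractSolution.regular (hμ : IsMemoryKernel μ) (hτ : 0 < τ)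
    (hu : IsAbstractSolution T G μ θ k τ u v) {p : ℝ → V} {a : ℝ → H} (hp : IsL2History μ p)
    (hpd : ∀ t, 0 ≤ t → HasDerivWithinAt u (p t) (Ici 0) t)
    (hpu : ∀ s, 0 < s → 0 < μ s → u (-s) = u 0 - ∫ r in (0 : ℝ)..s, p (-r))
    (ha : MemLp a 2 (volume.restrict (Ioo (-τ) 0)))
    (hav : ∀ t ∈ Icc (-τ) 0, v t = v 0 - ∫ r in t..(0 : ℝ), a r) [CompleteSpace V] :
    (∀ t, 0 ≤ t → IntegrableOn (fun s => deriv μ s * ‖G (u t) - G (u (t - s))‖ ^ 2) (Ioi 0)) ∧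
      ContinuousOn (energyRate μ θ k τ (fun t => G (u t)) v) (Ici 0) := by
  have hy : IsL2History μ fun t => G (p t) :=
    ⟨G.continuous.comp_continuousOn hp.continuousOn, G.comp_memLp' hp.memLp⟩
  have hpast : ∀ s, 0 < s → 0 < μ s → G (u (-s)) = G (u 0) -
      ∫ r in (0 : ℝ)..s, G (p (-r)) := by
    intro s hs h
    have hi : IntervalIntegrable (fun r => p (-r)) volume 0 s := by
      refine IntervalIntegrable.congr (fun r hr => ?_)
        ((hp.hasHistory hμ).intervalIntegrable_sub hμ le_rfl hs h)
      rw [uIoc_of_le hs.le] at hr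
      have h1 : μ s ≤ μ r := hμ.antitone hr.1.le hr.2
      rw [hμ.cutHistory_sub le_rfl hr.1 (h.trans_le h1).ne', zero_sub]
    rw [hpu s hs h, map_sub, ← G.intervalIntegral_comp_comm hi]
  have hreg := hu.isL2History.regular_dissipation hμ hy
    (fun t ht => G.hasFDerivAt.comp_hasDerivWithinAt t (hpd t ht)) hpast
  refine ⟨hreg.1, ?_⟩
  have hd := hu.continuousOn_delay_velocity hτ ha hav
  have hZ := (delay_energy_eq hτ fun t ht => hu.intervalIntegrable_v_sq hτ ht).1
  exact ((((continuousOn_const.mul hreg.2).sub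
    (continuousOn_const.mul (hu.continuousOn_v.norm.pow 2))).sub
    (continuousOn_const.mul (hd.inner hu.continuousOn_v))).sub
    (continuousOn_const.mul (hd.norm.pow 2))).sub (continuousOn_const.mul hZ)

variable [CompleteSpace H]

/-- The wave part of the energy balance: the memory term of the equation is the gradient term with
`γ(t) = ∫₀^∞ μ(s) G u(t-s) ds`, which is absolutely continuous in time, and the two damping terms
are a source in `L¹` in time. -/
theorem IsAbstractSolution.wave_identity (hμ : IsMemoryKernel μ) (hτ : 0 < τ)
    (hu : IsAbstractSolution T G μ θ k τ u v) {t : ℝ} (ht : 0 ≤ t) :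
    1 / 2 * ‖v t‖ ^ 2 + 1 / 2 * ‖G (u t)‖ ^ 2
        - inner ℝ (∫ s in Ioi 0, μ s • cutHistory μ (fun t => G (u t)) (t - s)) (G (u t)) =
      1 / 2 * ‖v 0‖ ^ 2 + 1 / 2 * ‖G (u 0)‖ ^ 2
        - inner ℝ (∫ s in Ioi 0, μ s • cutHistory μ (fun t => G (u t)) (0 - s)) (G (u 0)) -
        ((∫ r in (0 : ℝ)..t, inner ℝ ((θ * |k| * Real.exp τ) • v r + k • v (r - τ)) (v r)) +
        ∫ r in (0 : ℝ)..t, inner ℝ (μ 0 • cutHistory μ (fun t => G (u t)) r +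
          ∫ s in Ioi 0, deriv μ s • cutHistory μ (fun t => G (u t)) (r - s)) (G (u r))) := by
  set c := θ * |k| * Real.exp τ
  set x : ℝ → W := fun t => G (u t) with hxdef
  have hx := hu.isL2History
  have hxh := hx.hasHistory hμ
  set f : ℝ → H := fun r => c • v r + k • v (r - τ) with hfdef
  have hvi : ∀ t, 0 ≤ t → IntervalIntegrable v volume 0 t := fun t ht =>
    (hu.intervalIntegrable_v hτ le_rfl).symm.trans (hu.intervalIntegrable_v hτ ht)
  have hfi : ∀ t, 0 ≤ t → IntervalIntegrable f volume 0 t := fun t ht =>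
    ((hvi t ht).smul c).add ((intervalIntegrable_delay hτ
      (fun t ht => hu.intervalIntegrable_v hτ ht) ht).smul k)
  have hmax : ∀ r : ℝ, 0 ≤ r → max r 0 = r := fun r hr => max_eq_left hr
  have hmaxc : Continuous fun r : ℝ => max r 0 := continuous_id.max continuous_const
  -- `wave_energy_identity` asks for continuity on the whole line; only `[0, ∞)` matters
  have huc : Continuous fun r => u (max r 0) :=
    hu.continuousOn_u.comp_continuous hmaxc fun r => mem_Ici.2 (le_max_right _ _)
  have hvc : Continuous fun r => v (max r 0) :=
    hu.continuousOn_v.comp_continuous hmaxc fun r => mem_Ici.2 (le_max_right _ _)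
  have key := wave_energy_identity T G (f := f)
    (γ := fun t => ∫ s in Ioi 0, μ s • cutHistory μ x (t - s))
    (γ' := fun r => μ 0 • cutHistory μ x r + ∫ s in Ioi 0, deriv μ s • cutHistory μ x (r - s))
    huc hvc hfi (fun t ht => hxh.intervalIntegrable_memory_deriv hμ ht)
    (fun t ht => hxh.memory_eq hμ ht) ?_ ?_ ht
  · simp only [hmax t ht, max_self] at key
    rw [key]
    congr 1
    have hGuc : Continuous fun r => G (u (max r 0)) := G.continuous.comp huc
    rw [intervalIntegral.integral_add
      (intervalIntegrable_inner (hfi t ht) hvc.continuousOn)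
      (intervalIntegrable_inner (hxh.intervalIntegrable_memory_deriv hμ ht) hGuc.continuousOn)]
    congr 1
    · exact integral_congr_of_nonneg ht fun r hr => by rw [hmax r hr]
    · exact integral_congr_of_nonneg ht fun r hr => by rw [hmax r hr]
  · intro t ht
    simp only [hmax t ht, max_self]
    rw [integral_congr_of_nonneg ht (φ := fun r => v (max r 0)) (ψ := v)
      fun r hr => by rw [hmax r hr]]
    rw [intervalIntegral.integral_eq_sub_of_hasDeriv_right_of_le ht
      (f := fun r => T (u r))
      (fun r hr => ((hu.hasDeriv_u r hr.1).continuousWithinAt).mono Icc_subset_Ici_self)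
      (fun r hr => (hu.hasDeriv_u r hr.1.le).mono fun y hy => hr.1.le.trans (le_of_lt hy))
      (hvi t ht)]
    abel
  · intro w t ht
    simp only [hmax t ht, max_self]
    refine Eq.trans ?_ (hu.equation w t ht)
    congr 1
    refine integral_congr_of_nonneg ht fun r hr => ?_
    have e : ∫ s in Ioi 0, μ s * inner ℝ (G (u (r - s))) (G w) =
        inner ℝ (∫ s in Ioi 0, μ s • cutHistory μ x (r - s)) (G w) := by
      rw [real_inner_comm, ← integral_inner (hxh.integrableOn_memory hμ hr)]
      refine setIntegral_congr_fun measurableSet_Ioi fun s hs => ?_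
      rw [real_inner_smul_right, real_inner_comm]
      rcases eq_or_ne (μ s) 0 with h | h
      · rw [h, zero_mul, zero_mul]
      · rw [hμ.cutHistory_sub hr hs h]
    rw [e, hmax r hr, hfdef]
    simp only [inner_add_left, real_inner_smul_left]
    ring

/-- The energy balance in integrated form. -/
theorem IsAbstractSolution.energy_eq (hμ : IsMemoryKernel μ) (hτ : 0 < τ)
    (hu : IsAbstractSolution T G μ θ k τ u v) {t : ℝ} (ht : 0 ≤ t) :
    historyEnergy μ θ k τ (fun t => G (u t)) v t = historyEnergy μ θ k τ (fun t => G (u t)) v 0 +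
      ∫ r in (0 : ℝ)..t, energyRate μ θ k τ (fun t => G (u t)) v r := by
  have hsub : uIcc 0 t ⊆ Ici 0 := by rw [uIcc_of_le ht]; exact Icc_subset_Ici_self
  have hw : ∀ t, 0 ≤ t → IntervalIntegrable (fun s => ‖v s‖ ^ 2) volume (-τ) t :=
    fun _ ht => hu.intervalIntegrable_v_sq hτ ht
  have hx := hu.isL2History
  have i1 := hx.intervalIntegrable_deriv_norm_sq hμ ht
  have i2 : IntervalIntegrable (fun s => ‖v s‖ ^ 2) volume 0 t :=
    (hw 0 le_rfl).symm.trans (hw t ht)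
  have i3 := hu.intervalIntegrable_damping hτ ht
  have i4 := intervalIntegrable_delay hτ hw ht
  have i5 := ((delay_energy_eq hτ hw).1.mono hsub).intervalIntegrable (μ := volume)
  have e1 := hu.wave_identity hμ hτ ht
  have e2 := hx.memory_balance hμ ht
  have e3 := hx.integral_memory_norm_sq hμ ht
  have e4 := hx.integral_memory_norm_sq hμ le_rfl
  have e5 := (delay_energy_eq hτ hw).2 t ht
  have e6 : ∫ r in (0 : ℝ)..t, inner ℝ ((θ * |k| * Real.exp τ) • v r + k • v (r - τ)) (v r) =
      θ * |k| * Real.exp τ * (∫ r in (0 : ℝ)..t, ‖v r‖ ^ 2) +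
        k * ∫ r in (0 : ℝ)..t, inner ℝ (v (r - τ)) (v r) := by
    rw [← intervalIntegral.integral_const_mul, ← intervalIntegral.integral_const_mul,
      ← intervalIntegral.integral_add (i2.const_mul _) (i3.const_mul _)]
    refine intervalIntegral.integral_congr fun r _ => ?_
    simp only [inner_add_left, real_inner_smul_left, real_inner_self_eq_norm_sq]
  have e7 : ∫ r in (0 : ℝ)..t, (‖v r‖ ^ 2 - Real.exp (-τ) * ‖v (r - τ)‖ ^ 2
        - ∫ s in (r - τ)..r, Real.exp (-(r - s)) * ‖v s‖ ^ 2) =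
      (∫ r in (0 : ℝ)..t, ‖v r‖ ^ 2) - Real.exp (-τ) * (∫ r in (0 : ℝ)..t, ‖v (r - τ)‖ ^ 2)
        - ∫ r in (0 : ℝ)..t, ∫ s in (r - τ)..r, Real.exp (-(r - s)) * ‖v s‖ ^ 2 := by
    rw [intervalIntegral.integral_sub (i2.sub (i4.const_mul _)) i5,
      intervalIntegral.integral_sub i2 (i4.const_mul _), intervalIntegral.integral_const_mul]
  have e8 : ∫ r in (0 : ℝ)..t, energyRate μ θ k τ (fun t => G (u t)) v r =
      1 / 2 * (∫ r in (0 : ℝ)..t, ∫ s in Ioi 0, deriv μ s * ‖G (u r) - G (u (r - s))‖ ^ 2)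
      - θ * |k| * Real.exp τ / 2 * (∫ r in (0 : ℝ)..t, ‖v r‖ ^ 2)
      - k * (∫ r in (0 : ℝ)..t, inner ℝ (v (r - τ)) (v r))
      - θ * |k| / 2 * (∫ r in (0 : ℝ)..t, ‖v (r - τ)‖ ^ 2)
      - θ * |k| * Real.exp τ / 2 *
        ∫ r in (0 : ℝ)..t, ∫ s in (r - τ)..r, Real.exp (-(r - s)) * ‖v s‖ ^ 2 := by
    have j1 := (i1.const_mul (1 / 2)).sub (i2.const_mul (θ * |k| * Real.exp τ / 2))
    have j2 := j1.sub (i3.const_mul k)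
    have j3 := j2.sub (i4.const_mul (θ * |k| / 2))
    rw [← intervalIntegral.integral_const_mul, ← intervalIntegral.integral_const_mul,
      ← intervalIntegral.integral_const_mul, ← intervalIntegral.integral_const_mul,
      ← intervalIntegral.integral_const_mul,
      ← intervalIntegral.integral_sub (i1.const_mul _) (i2.const_mul _),
      ← intervalIntegral.integral_sub j1 (i3.const_mul _),
      ← intervalIntegral.integral_sub j2 (i4.const_mul _),
      ← intervalIntegral.integral_sub j3 (i5.const_mul _)]
    refine intervalIntegral.integral_congr fun r _ => ?_
    simp only [energyRate]
  have e9 : Real.exp τ * Real.exp (-τ) = 1 := by rw [← Real.exp_add]; simp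
  simp only [historyEnergy]
  rw [e3, e4, e5, e7, e8]
  rw [e6] at e1
  linear_combination e1 + 1 / 2 * e2
    - θ * |k| / 2 * (∫ r in (0 : ℝ)..t, ‖v (r - τ)‖ ^ 2) * e9

theorem IsAbstractSolution.antitoneOn_energy (hμ : IsMemoryKernel μ) (hθ : 1 < θ) (hτ : 0 < τ)
    (hu : IsAbstractSolution T G μ θ k τ u v) :
    AntitoneOn (historyEnergy μ θ k τ (fun t => G (u t)) v) (Ici 0) := by
  intro a ha b hb hab
  rw [hu.energy_eq hμ hτ ha, hu.energy_eq hμ hτ hb, add_le_add_iff_left, ← sub_nonpos,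
    intervalIntegral.integral_interval_sub_left (hu.intervalIntegrable_energyRate hμ hτ hb)
      (hu.intervalIntegrable_energyRate hμ hτ ha)]
  rw [← neg_nonneg, ← intervalIntegral.integral_neg]
  exact intervalIntegral.integral_nonneg hab fun r _ => neg_nonneg.2
    ((energyRate_le_dissipation r).trans (dissipation_nonpos hμ hθ hτ r))

theorem IsAbstractSolution.ae_hasDerivAt_energy (hμ : IsMemoryKernel μ) (hτ : 0 < τ)
    (hu : IsAbstractSolution T G μ θ k τ u v) : ∀ᵐ t ∂(volume.restrict (Ioi (0 : ℝ))),
      HasDerivAt (historyEnergy μ θ k τ (fun t => G (u t)) v)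
        (energyRate μ θ k τ (fun t => G (u t)) v t) t := by
  have h : ∀ᵐ t : ℝ, ∀ n : ℕ, t ∈ uIcc (0 : ℝ) n → ∀ c ∈ uIcc (0 : ℝ) n,
      HasDerivAt (fun x => ∫ r in c..x, energyRate μ θ k τ (fun t => G (u t)) v r)
        (energyRate μ θ k τ (fun t => G (u t)) v t) t :=
    ae_all_iff.2 fun n =>
      (hu.intervalIntegrable_energyRate hμ hτ n.cast_nonneg).ae_hasDerivAt_integral
  filter_upwards [ae_restrict_of_ae h, ae_restrict_mem measurableSet_Ioi] with t ht ht0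
  obtain ⟨n, hn⟩ := exists_nat_ge t
  have h1 := ht n (by rw [uIcc_of_le n.cast_nonneg]; exact ⟨le_of_lt ht0, hn⟩) 0 left_mem_uIcc
  refine (h1.const_add (historyEnergy μ θ k τ (fun t => G (u t)) v 0)).congr_of_eventuallyEq ?_
  filter_upwards [Ioi_mem_nhds ht0] with s hs
  exact hu.energy_eq hμ hτ (le_of_lt hs)

theorem IsAbstractSolution.hasDerivWithinAt_energy (hμ : IsMemoryKernel μ) (hτ : 0 < τ)
    (hu : IsAbstractSolution T G μ θ k τ u v)
    (hc : ContinuousOn (energyRate μ θ k τ (fun t => G (u t)) v) (Ici 0)) {t : ℝ}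
    (ht : 0 ≤ t) :
    HasDerivWithinAt (historyEnergy μ θ k τ (fun t => G (u t)) v)
      (energyRate μ θ k τ (fun t => G (u t)) v t) (Ici 0) t := by
  have hD : Continuous fun r => energyRate μ θ k τ (fun t => G (u t)) v (max r 0) :=
    hc.comp_continuous (continuous_id.max continuous_const) fun r => mem_Ici.2 (le_max_right _ _)
  have h1 := ((hD.integral_hasStrictDerivAt 0 t).hasDerivAt.const_add
    (historyEnergy μ θ k τ (fun t => G (u t)) v 0)).hasDerivWithinAt (s := Ici 0)
  rw [max_eq_left ht] at h1
  have h2 : ∀ s ∈ Ici (0 : ℝ),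
      historyEnergy μ θ k τ (fun t => G (u t)) v s = historyEnergy μ θ k τ (fun t => G (u t)) v 0 +
      ∫ r in (0 : ℝ)..s, energyRate μ θ k τ (fun t => G (u t)) v (max r 0) := fun s hs => by
    rw [hu.energy_eq hμ hτ hs]
    congr 1
    refine intervalIntegral.integral_congr fun r hr => ?_
    rw [uIcc_of_le hs] at hr
    simp only [max_eq_left hr.1]
  exact h1.congr h2 (h2 t ht)

end Solution

/-! ### The concrete problem -/

section Specialization

variable {n : ℕ} {Ω : Set (Pt n)} {μ : ℝ → ℝ} {θ k τ : ℝ} {u : ℝ → H10 Ω} {v : ℝ → L2 Ω}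

theorem IsSolution.isL2History (hμ : IsMemoryKernel μ) (hu : IsSolution Ω μ θ k τ u v) :
    IsL2History μ fun t => grad (u t) where
  continuousOn := grad.continuous.comp_continuousOn hu.continuousOn_u
  memLp := by
    have := memoryMeasure_isFinite hμ
    have h1 : MemLp (fun s => u (-s)) 2 (memoryMeasure μ) := by
      have h2 := (memLp_const (μ := memoryMeasure μ) (p := 2) (u 0)).sub hu.history_u
      have e : ((fun _ => u 0) - fun s => eta u 0 s) = fun s => u (-s) := by
        funext s
        simp [eta]
      rwa [e] at h2
    exact grad.comp_memLp' h1

theorem IsSolution.isAbstractSolution (hμ : IsMemoryKernel μ) (hu : IsSolution Ω μ θ k τ u v) :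
    IsAbstractSolution toL2 grad μ θ k τ u v where
  continuousOn_u := hu.continuousOn_u
  continuousOn_v := hu.continuousOn_v
  hasDeriv_u := hu.hasDeriv_u
  isL2History := hu.isL2History hμ
  history_v := hu.history_v
  equation := hu.equation

theorem energy_eq_historyEnergy :
    energy μ θ k τ u v = historyEnergy μ θ k τ (fun t => grad (u t)) v := by
  funext t
  simp only [energy, historyEnergy, eta, map_sub]

theorem dissipation_eq_historyDissipation (t : ℝ) :
    dissipation μ θ k τ u v t = historyDissipation μ θ k τ (fun t => grad (u t)) v t := by
  simp only [dissipation, historyDissipation, eta, map_sub]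

end Specialization
end ViscoelasticDelay

end
theorem proposition3p1 {n : ℕ} (Ω : Set (ViscoelasticDelay.Pt n))
    (hΩ : IsOpen Ω) (hΩb : Bornology.IsBounded Ω)
    (μ : ℝ → ℝ) (hμ : ViscoelasticDelay.IsMemoryKernel μ)
    (θ k τ : ℝ) (hθ : 1 < θ) (hτ : 0 < τ)
    (u : ℝ → ViscoelasticDelay.H10 Ω) (v : ℝ → ViscoelasticDelay.L2 Ω)
    (hu : ViscoelasticDelay.IsSolution Ω μ θ k τ u v) :
    AntitoneOn (ViscoelasticDelay.energy μ θ k τ u v) (Ici 0) ∧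
    (∀ᵐ t ∂(volume.restrict (Ioi (0 : ℝ))),
      IntegrableOn
        (fun s => deriv μ s * ‖ViscoelasticDelay.grad (ViscoelasticDelay.eta u t s)‖ ^ 2)
        (Ioi 0) ∧
      ∃ F' : ℝ, HasDerivAt (ViscoelasticDelay.energy μ θ k τ u v) F' t ∧
        F' ≤ ViscoelasticDelay.dissipation μ θ k τ u v t) ∧
    (ViscoelasticDelay.IsRegular μ τ u v → ∀ t, 0 ≤ t →
      IntegrableOn
        (fun s => deriv μ s * ‖ViscoelasticDelay.grad (ViscoelasticDelay.eta u t s)‖ ^ 2)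
        (Ioi 0) ∧
      ∃ F' : ℝ, HasDerivWithinAt (ViscoelasticDelay.energy μ θ k τ u v) F' (Ici 0) t ∧
        F' ≤ ViscoelasticDelay.dissipation μ θ k τ u v t) := by
  have ha := hu.isAbstractSolution hμ
  rw [ViscoelasticDelay.energy_eq_historyEnergy]
  simp only [ViscoelasticDelay.dissipation_eq_historyDissipation, ViscoelasticDelay.eta, map_sub]
  refine ⟨ha.antitoneOn_energy hμ hθ hτ, ?_, ?_⟩
  · filter_upwards [ha.isL2History.ae_integral_deriv_norm_sq hμ, ha.ae_hasDerivAt_energy hμ hτ]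
      with t h1 h2
    exact ⟨h1.1, _, h2, ViscoelasticDelay.energyRate_le_dissipation t⟩
  · rintro ⟨p, a, hpc, hpd, -, -, hpm, hpu, ham, hav⟩ t ht
    have hp : ViscoelasticDelay.IsL2History μ p := ⟨hpc, hpm⟩
    have hreg := ha.regular hμ hτ hp hpd hpu ham hav
    exact ⟨hreg.1 t ht, _, ha.hasDerivWithinAt_energy hμ hτ hreg.2 ht,
      ViscoelasticDelay.energyRate_le_dissipation t⟩
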